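/- Let $\mathcal B$ be the set of finite binary trees generated by a leaf $\circ$ and by forming $\circ(s,t)$ from $s,t\in\mathcal B$. Let $\leq_{\mathcal B}$ be defined recursively as follows: $\circ\leq_{\mathcal B}t$ always holds, $s\leq_{\mathcal B}\circ$ holds only for $s=\circ$, and $\circ(s_0,s_1)\leq_{\mathcal B}\circ(t_0,t_1)$ holds if and only if ($s_0\leq_{\mathcal B}t_0$ and $s_1\leq_{\mathcal B}t_1$) or $\circ(s_0,s_1)\leq_{\mathcal B}t_i$ for some $i\in\{0,1\}$. Let $\mathcal L_2$ be the two-sorted language of second order arithmetic, with number terms built from $0,S,+,\times$ and with prime formulas $s=t$, $s\leq t$ and $t\in X$. Let $\mathsf{ACA}_0$ be the $\mathcal L_2$-theory whose axioms are the equality axioms (including $x=y\land x\in X\to y\in X$), the axioms of Robinson arithmetic, the induction axiom $0\in X\land\forall x(x\in X\to Sx\in X)\to\forall x.\,x\in X$ for a set variable $X$, and the comprehension axioms $\exists X\forall x(x\in X\leftrightarrow\varphi(x))$ for all formulas $\varphi$ without set quantifiers (with number and set parameters, and with $X$ not free in $\varphi$); all axioms are universally closed. Provability refers to a sequent calculus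 (with cut) for classical two-sorted predicate logic. Trees are coded by natural numbers: $\circ$ by $0$, and $\circ(s,t)$ by $\langle s,t\rangle+1$, where $\langle x,y\rangle=(x+y)(x+y+1)/2+y$ is Cantor pairing. In $\mathcal L_2$, the relation $p=\langle x,y\rangle$ is expressed by $p+p=(x+y)\times S(x+y)+(y+y)$. The relations $t\in\mathcal B$ and $s\leq_{\mathcal B}t$ are expressed by formulas without set quantifiers or set variables, which state that there is a finite verification according to the recursive clauses; that is, there is a (coded) finite set of numbers, respectively of pairs, that contains $t$, respectively $\langle s,t\rangle$, and in which each element is justified by a clause of the definition from elements of the set. Here the triple $(k,c,d)$ codes the finite set of all $x<k$ such that $d(x+1)+1$ divides $c$. **Theorem.** $\mathsf{ACA}_0$ does not prove Kruskal's theorem for binary trees, i.e., $\mathsf{ACA}_0$ does not prove the $\mathcal L_2$-sentence $$\forall X\big[\forall i\,\exists t,p\,(t\in\mathcal B\land p=\langle i,t\rangle\land p\in X)\to\exists i,j,s,t,p,q\,(i<j\land s,t\in\mathcal B\land p=\langle i,s\rangle\land q=\langle j,t\rangle\land p,q\in X\land s\leq_{\mathcal B}t)\big].$$ -/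

import Mathlib

/-!
Second order arithmetic: the two-sorted language, a Tait-style sequent calculus for it, the theory
of arithmetical comprehension, and Kruskal's theorem for binary trees as a sentence of the language.

Variables are de Bruijn indices. There are two independent families of them, one for number
variables and one for set variables; a number quantifier binds number variable `0` and a set
quantifier binds set variable `0`.
-/

namespace SecondOrderArith

/-! ### Terms and formulas -/

/-- Terms of the language of Peano arithmetic, with constant `0`, successor, `+` and `×`. -/
inductive Term : Type
  | var (i : ℕ)
  | zero
  | succ (t : Term)
  | add (s t : Term)
  | mul (s t : Term)
  deriving DecidableEq

/-- Prime formulas `s = t`, `s ≤ t` and `t ∈ X`, where `X` is the set variable with index `j`. -/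
inductive Atom : Type
  | eq (s t : Term)
  | le (s t : Term)
  | mem (t : Term) (j : ℕ)
  deriving DecidableEq

/-- Formulas of second order arithmetic in negation normal form. -/
inductive Formula : Type
  | pos (a : Atom)
  | neg (a : Atom)
  | and (φ ψ : Formula)
  | or (φ ψ : Formula)
  | all (φ : Formula)
  | ex (φ : Formula)
  | allSet (φ : Formula)
  | exSet (φ : Formula)
  deriving DecidableEq

infixr:65 " ⋏ " => Formula.and
infixr:60 " ⋎ " => Formula.or

/-! ### Substitution -/

/-- Simultaneous substitution of terms for number variables. -/
def Term.subst (σ : ℕ → Term) : Term → Term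
  | .var i => σ i
  | .zero => .zero
  | .succ t => .succ (t.subst σ)
  | .add s t => .add (s.subst σ) (t.subst σ)
  | .mul s t => .mul (s.subst σ) (t.subst σ)

/-- `t.lift k` is `t` with all its variables moved past `k` new quantifiers. -/
def Term.lift (k : ℕ) (t : Term) : Term := t.subst fun i => .var (i + k)

/-- A substitution for number variables, transported below a number quantifier. -/
def liftTerms (σ : ℕ → Term) : ℕ → Term
  | 0 => .var 0
  | i + 1 => (σ i).lift 1

/-- A renaming of set variables, transported below a set quantifier. -/
def liftSets (τ : ℕ → ℕ) : ℕ → ℕ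
  | 0 => 0
  | j + 1 => τ j + 1

def Atom.subst (σ : ℕ → Term) (τ : ℕ → ℕ) : Atom → Atom
  | .eq s t => .eq (s.subst σ) (t.subst σ)
  | .le s t => .le (s.subst σ) (t.subst σ)
  | .mem t j => .mem (t.subst σ) (τ j)

/-- Simultaneous capture-free substitution of terms for the free number variables and of set
variables for the free set variables. -/
def Formula.subst : Formula → (ℕ → Term) → (ℕ → ℕ) → Formula
  | .pos a, σ, τ => .pos (a.subst σ τ)
  | .neg a, σ, τ => .neg (a.subst σ τ)
  | .and φ ψ, σ, τ => .and (φ.subst σ τ) (ψ.subst σ τ)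
  | .or φ ψ, σ, τ => .or (φ.subst σ τ) (ψ.subst σ τ)
  | .all φ, σ, τ => .all (φ.subst (liftTerms σ) τ)
  | .ex φ, σ, τ => .ex (φ.subst (liftTerms σ) τ)
  | .allSet φ, σ, τ => .allSet (φ.subst σ (liftSets τ))
  | .exSet φ, σ, τ => .exSet (φ.subst σ (liftSets τ))

/-- The free number variable `0` becomes fresh, the other ones are renumbered. -/
def Formula.shift (φ : Formula) : Formula := φ.subst (fun i => .var (i + 1)) id

/-- The free set variable `0` becomes fresh, the other ones are renumbered. -/
def Formula.shiftSet (φ : Formula) : Formula := φ.subst .var (fun j => j + 1)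

/-- `φ[x/t]` for the body `φ` of a number quantifier. -/
def Formula.inst (φ : Formula) (t : Term) : Formula :=
  φ.subst (fun i => match i with | 0 => t | i + 1 => .var i) id

/-- `φ[X/Y]` for the body `φ` of a set quantifier, where `Y` is the set variable with index `k`. -/
def Formula.instSet (φ : Formula) (k : ℕ) : Formula :=
  φ.subst .var (fun j => match j with | 0 => k | j + 1 => j)

/-! ### Defined connectives -/

/-- Negation, by de Morgan's rules. -/
def Formula.not : Formula → Formula
  | .pos a => .neg a
  | .neg a => .pos a
  | .and φ ψ => .or φ.not ψ.not
  | .or φ ψ => .and φ.not ψ.not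
  | .all φ => .ex φ.not
  | .ex φ => .all φ.not
  | .allSet φ => .exSet φ.not
  | .exSet φ => .allSet φ.not

def Formula.imp (φ ψ : Formula) : Formula := φ.not ⋎ ψ

def Formula.iff (φ ψ : Formula) : Formula := φ.imp ψ ⋏ ψ.imp φ

/-- `∃ x₁ ⋯ ∃ xₖ` over numbers; in the body, `xₖ` has index `0` and `x₁` has index `k - 1`. -/
def Formula.exs : ℕ → Formula → Formula
  | 0, φ => φ
  | k + 1, φ => .ex (φ.exs k)

/-- `∀ x₁ ⋯ ∀ xₖ` over numbers. -/
def Formula.alls : ℕ → Formula → Formula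
  | 0, φ => φ
  | k + 1, φ => .all (φ.alls k)

/-- `∀ X₁ ⋯ ∀ Xₖ` over sets. -/
def Formula.allSets : ℕ → Formula → Formula
  | 0, φ => φ
  | k + 1, φ => .allSet (φ.allSets k)

/-! ### Sequent calculus -/

/-- Derivability of a sequent (a finite set of formulas, read as their disjunction) in the
Tait-style sequent calculus for classical two-sorted predicate logic, with cut. Each rule allows
further side formulas in its conclusion `Δ`. In the rules for `∀`, the eigenvariable is the variable
with index `0`; it does not occur in the side formulas, since these have been shifted. -/
inductive Derivable : Finset Formula → Prop
  | ax {Δ : Finset Formula} (a : Atom) : .pos a ∈ Δ → .neg a ∈ Δ → Derivable Δ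
  | and {Γ Δ : Finset Formula} (φ ψ : Formula) :
      Derivable (insert φ Γ) → Derivable (insert ψ Γ) → insert (φ ⋏ ψ) Γ ⊆ Δ → Derivable Δ
  | orLeft {Γ Δ : Finset Formula} (φ ψ : Formula) :
      Derivable (insert φ Γ) → insert (φ ⋎ ψ) Γ ⊆ Δ → Derivable Δ
  | orRight {Γ Δ : Finset Formula} (φ ψ : Formula) :
      Derivable (insert ψ Γ) → insert (φ ⋎ ψ) Γ ⊆ Δ → Derivable Δ
  | all {Γ Δ : Finset Formula} (φ : Formula) :
      Derivable (insert φ (Γ.image Formula.shift)) → insert (.all φ) Γ ⊆ Δ → Derivable Δ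
  | ex {Γ Δ : Finset Formula} (φ : Formula) (t : Term) :
      Derivable (insert (φ.inst t) Γ) → insert (.ex φ) Γ ⊆ Δ → Derivable Δ
  | allSet {Γ Δ : Finset Formula} (φ : Formula) :
      Derivable (insert φ (Γ.image Formula.shiftSet)) → insert (.allSet φ) Γ ⊆ Δ → Derivable Δ
  | exSet {Γ Δ : Finset Formula} (φ : Formula) (k : ℕ) :
      Derivable (insert (φ.instSet k) Γ) → insert (.exSet φ) Γ ⊆ Δ → Derivable Δ
  | cut {Γ Δ : Finset Formula} (φ : Formula) :
      Derivable (insert φ Γ) → Derivable (insert φ.not Γ) → Γ ⊆ Δ → Derivable Δ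

/-- `T` proves `φ`: for some axioms `ψ₁, …, ψₙ` of `T`, the sequent `¬ψ₁, …, ¬ψₙ, φ` is
derivable. -/
def Provable (T : Set Formula) (φ : Formula) : Prop :=
  ∃ Ψ : Finset Formula, (∀ ψ ∈ Ψ, ψ ∈ T) ∧ Derivable (insert φ (Ψ.image Formula.not))

/-! ### The theory of arithmetical comprehension -/

/-- All variables of the term have index below `n`. -/
def Term.VarsBelow (n : ℕ) : Term → Prop
  | .var i => i < n
  | .zero => True
  | .succ t => t.VarsBelow n
  | .add s t => s.VarsBelow n ∧ t.VarsBelow n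
  | .mul s t => s.VarsBelow n ∧ t.VarsBelow n

def Atom.VarsBelow (n m : ℕ) : Atom → Prop
  | .eq s t => s.VarsBelow n ∧ t.VarsBelow n
  | .le s t => s.VarsBelow n ∧ t.VarsBelow n
  | .mem t j => t.VarsBelow n ∧ j < m

/-- All free number variables have index below `n` and all free set variables have index
below `m`. -/
def Formula.FreeBelow : ℕ → ℕ → Formula → Prop
  | n, m, .pos a => a.VarsBelow n m
  | n, m, .neg a => a.VarsBelow n m
  | n, m, .and φ ψ => φ.FreeBelow n m ∧ ψ.FreeBelow n m
  | n, m, .or φ ψ => φ.FreeBelow n m ∧ ψ.FreeBelow n m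
  | n, m, .all φ => φ.FreeBelow (n + 1) m
  | n, m, .ex φ => φ.FreeBelow (n + 1) m
  | n, m, .allSet φ => φ.FreeBelow n (m + 1)
  | n, m, .exSet φ => φ.FreeBelow n (m + 1)

/-- No set quantifiers; free set variables are allowed. -/
def Formula.IsArithmetical : Formula → Prop
  | .pos _ => True
  | .neg _ => True
  | .and φ ψ => φ.IsArithmetical ∧ ψ.IsArithmetical
  | .or φ ψ => φ.IsArithmetical ∧ ψ.IsArithmetical
  | .all φ => φ.IsArithmetical
  | .ex φ => φ.IsArithmetical
  | .allSet _ => False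
  | .exSet _ => False

/-- `∃ X ∀ x (x ∈ X ↔ φ(x))`, where `x` is the number variable `0` of `φ`; the other free variables
of `φ` are parameters, and `X` is not free in `φ`. -/
def comprehension (φ : Formula) : Formula :=
  .exSet (.all (Formula.iff (.pos (.mem (.var 0) 0)) φ.shiftSet))

open Term Formula in
/-- The equality axioms. -/
inductive EqualityAxiom : Formula → Prop
  | refl : EqualityAxiom (alls 1 (pos (.eq (var 0) (var 0))))
  | symm : EqualityAxiom
      (alls 2 (imp (pos (.eq (var 0) (var 1))) (pos (.eq (var 1) (var 0)))))
  | trans : EqualityAxiom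
      (alls 3 (imp (pos (.eq (var 0) (var 1)) ⋏ pos (.eq (var 1) (var 2)))
        (pos (.eq (var 0) (var 2)))))
  | succ : EqualityAxiom
      (alls 2 (imp (pos (.eq (var 0) (var 1))) (pos (.eq (succ (var 0)) (succ (var 1))))))
  | add : EqualityAxiom
      (alls 4 (imp (pos (.eq (var 0) (var 1)) ⋏ pos (.eq (var 2) (var 3)))
        (pos (.eq (add (var 0) (var 2)) (add (var 1) (var 3))))))
  | mul : EqualityAxiom
      (alls 4 (imp (pos (.eq (var 0) (var 1)) ⋏ pos (.eq (var 2) (var 3)))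
        (pos (.eq (mul (var 0) (var 2)) (mul (var 1) (var 3))))))
  | le : EqualityAxiom
      (alls 4 (imp (pos (.eq (var 0) (var 1)) ⋏ pos (.eq (var 2) (var 3)) ⋏
          pos (.le (var 0) (var 2)))
        (pos (.le (var 1) (var 3)))))
  | mem : EqualityAxiom
      (allSet (alls 2 (imp (pos (.eq (var 0) (var 1)) ⋏ pos (.mem (var 0) 0))
        (pos (.mem (var 1) 0)))))

open Term Formula in
/-- The axioms of Robinson arithmetic. -/
inductive RobinsonAxiom : Formula → Prop
  /-- `S x ≠ 0` -/
  | succ_ne_zero : RobinsonAxiom (alls 1 (neg (.eq (succ (var 0)) zero)))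
  /-- `S x = S y → x = y` -/
  | succ_inj : RobinsonAxiom
      (alls 2 (imp (pos (.eq (succ (var 1)) (succ (var 0)))) (pos (.eq (var 1) (var 0)))))
  /-- `x ≠ 0 → ∃ y, x = S y` -/
  | exists_pred : RobinsonAxiom
      (alls 1 (imp (neg (.eq (var 0) zero)) (ex (pos (.eq (var 1) (succ (var 0)))))))
  /-- `x + 0 = x` -/
  | add_zero : RobinsonAxiom (alls 1 (pos (.eq (add (var 0) zero) (var 0))))
  /-- `x + S y = S (x + y)` -/
  | add_succ : RobinsonAxiom
      (alls 2 (pos (.eq (add (var 1) (succ (var 0))) (succ (add (var 1) (var 0))))))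
  /-- `x × 0 = 0` -/
  | mul_zero : RobinsonAxiom (alls 1 (pos (.eq (mul (var 0) zero) zero)))
  /-- `x × S y = (x × y) + x` -/
  | mul_succ : RobinsonAxiom
      (alls 2 (pos (.eq (mul (var 1) (succ (var 0))) (add (mul (var 1) (var 0)) (var 1)))))
  /-- `x ≤ y ↔ ∃ z, z + x = y` -/
  | le_iff : RobinsonAxiom
      (alls 2 (iff (pos (.le (var 1) (var 0))) (ex (pos (.eq (add (var 0) (var 2)) (var 1))))))

open Term Formula in
/-- `∀ X (0 ∈ X ∧ ∀ x (x ∈ X → S x ∈ X) → ∀ x, x ∈ X)` -/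
def setInduction : Formula :=
  allSet (imp (pos (.mem zero 0) ⋏ all (imp (pos (.mem (var 0) 0)) (pos (.mem (succ (var 0)) 0))))
    (all (pos (.mem (var 0) 0))))

/-- The axioms of `ACA₀`: equality, Robinson arithmetic, induction for sets, and the universal
closure of comprehension for each arithmetical formula. -/
inductive ACA0 : Set Formula
  | equality {φ : Formula} : EqualityAxiom φ → ACA0 φ
  | robinson {φ : Formula} : RobinsonAxiom φ → ACA0 φ
  | induction : ACA0 setInduction
  | comprehension (φ : Formula) (n m : ℕ) : φ.IsArithmetical →
      (comprehension φ).FreeBelow n m → ACA0 (.allSets m (.alls n (comprehension φ)))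

/-! ### Trees as numbers

The trees of the set `𝓑`, generated by `∘` and `∘(s, t)`, are coded by numbers: `∘` by `0`, and
`∘(s, t)` by `⟨s, t⟩ + 1`, where `⟨x, y⟩ = (x + y)(x + y + 1) / 2 + y` is Cantor pairing. -/

open Term Formula

/-- `s < t` -/
def lt (s t : Term) : Formula := pos (.le s t) ⋏ neg (.eq s t)

/-- `z = ⟨x, y⟩`, in the form `z + z = (x + y) × S (x + y) + (y + y)`. -/
def isPair (z x y : Term) : Formula :=
  pos (.eq (add z z) (add (mul (add x y) (succ (add x y))) (add y y)))

/-- `z` is the code of the tree `∘`. -/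
def isLeaf (z : Term) : Formula := pos (.eq z zero)

/-- `z` is the code of the tree `∘(x, y)`. -/
def isNode (z x y : Term) : Formula :=
  ex (isPair (var 0) (x.lift 1) (y.lift 1) ⋏ pos (.eq (z.lift 1) (succ (var 0))))

/-- `x` belongs to the finite set with code `(k, c, d)`, which consists of the numbers `x < k` for
which `d × (x + 1) + 1` divides `c`. Every finite set of numbers has such a code. -/
def inFin (x k c d : Term) : Formula :=
  lt x k ⋏ ex (pos (.eq (mul (var 0) (succ (mul (d.lift 1) (succ (x.lift 1))))) (c.lift 1)))

/-- `⟨x, y⟩` belongs to the finite set with code `(k, c, d)`. -/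
def pairInFin (x y k c d : Term) : Formula :=
  ex (isPair (var 0) (x.lift 1) (y.lift 1) ⋏ inFin (var 0) (k.lift 1) (c.lift 1) (d.lift 1))

/-- `x ∈ 𝓑`: some finite set contains `x`, and each of its elements `u` is `∘` or is `∘(u₀, u₁)` for
elements `u₀, u₁` of the set.

The variables are `∃ k c d` and `∀ u` and `∃ u₀ u₁`. -/
def isTree (x : Term) : Formula :=
  exs 3 (inFin (x.lift 3) (var 2) (var 1) (var 0) ⋏
    all (imp (inFin (var 0) (var 3) (var 2) (var 1))
      (isLeaf (var 0) ⋎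
        exs 2 (isNode (var 2) (var 1) (var 0) ⋏
          inFin (var 1) (var 5) (var 4) (var 3) ⋏ inFin (var 0) (var 5) (var 4) (var 3)))))

/-- `s ≤ t` in `𝓑`: some finite set contains `⟨s, t⟩`, and for each of its elements `⟨u, v⟩`, either
`u = ∘`, or `u = ∘(u₀, u₁)` and `v = ∘(v₀, v₁)`, and the set contains both `⟨u₀, v₀⟩` and
`⟨u₁, v₁⟩`, or it contains `⟨u, v₀⟩`, or it contains `⟨u, v₁⟩`. In other words, there is a finite
verification of `s ≤ t` by the recursive clauses for the order.

The variables are `∃ k c d` and `∀ u v` and `∃ u₀ u₁ v₀ v₁`. -/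
def treeLe (s t : Term) : Formula :=
  exs 3 (pairInFin (s.lift 3) (t.lift 3) (var 2) (var 1) (var 0) ⋏
    alls 2 (imp (pairInFin (var 1) (var 0) (var 4) (var 3) (var 2))
      (isLeaf (var 1) ⋎
        exs 4 (isNode (var 5) (var 3) (var 2) ⋏ isNode (var 4) (var 1) (var 0) ⋏
          (pairInFin (var 3) (var 1) (var 8) (var 7) (var 6) ⋏
              pairInFin (var 2) (var 0) (var 8) (var 7) (var 6) ⋎
            pairInFin (var 5) (var 1) (var 8) (var 7) (var 6) ⋎
            pairInFin (var 5) (var 0) (var 8) (var 7) (var 6))))))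

/-- Kruskal's theorem for binary trees:
`∀ X [∀ i ∃ t p (t ∈ 𝓑 ∧ p = ⟨i, t⟩ ∧ p ∈ X) →
  ∃ i j s t p q (i < j ∧ s, t ∈ 𝓑 ∧ p = ⟨i, s⟩ ∧ q = ⟨j, t⟩ ∧ p, q ∈ X ∧ s ≤ t)]`. -/
def kruskalBinary : Formula :=
  allSet (imp
    (all (exs 2 (isTree (var 1) ⋏ isPair (var 0) (var 2) (var 1) ⋏ pos (.mem (var 0) 0))))
    (exs 6 (lt (var 5) (var 4) ⋏ isTree (var 3) ⋏ isTree (var 2) ⋏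
      isPair (var 1) (var 5) (var 3) ⋏ isPair (var 0) (var 4) (var 2) ⋏
      pos (.mem (var 1) 0) ⋏ pos (.mem (var 0) 0) ⋏ treeLe (var 3) (var 2))))

end SecondOrderArith

namespace SecondOrderArith

open Ordinal

/-! The tree `∘(s, t)` receives the ordinal `ω ^ a + b`, where `a` and `b` belong to `s` and `t`.
Embeddings respect these ordinals (`treeOrd_le_of_verified`), and every ordinal below `ε₀` occurs
(`exists_treeOrd_eq`). An infinite sequence of trees with strictly descending ordinals would refute
Kruskal's theorem. No such sequence exists, but infinitary derivations of height below `ε₀` cannot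
detect this.

These derivations concern the set `X` of pairs `⟨i, t⟩` given by an unknown descending sequence, and
a query branches over all admissible next entries. Cut elimination keeps heights below `ε₀`
(`cut_elim`). A cut-free derivation of the empty sequent consists of queries only. Answering each
with a tree whose ordinal is the height of the premise yields an endless path through a well-founded
derivation, so the empty sequent is underivable (`not_empty`).

Forcing connects this with `ACA₀`. Conditions are families of sequents, consistent if not derivable
with one bound on height and cut rank, and sets are interpreted by sequences of propositional
formulas of bounded rank. Families are needed because heights that are individually below `ε₀` may
have supremum `ε₀`; number variables therefore take values that depend on the index. For
arithmetical formulas, forcing is derivability (`Formula.IsArithmetical.forces_iff`), which yields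
comprehension and induction. Forcing is sound for the sequent calculus (`Derivable.sound`), and `X`
itself witnesses the negation of Kruskal's theorem (`forces_not_kruskalBinary`). -/

/-! ### Cantor pairing and the ordinals of trees -/

/-- `z` is the Cantor pair of `x` and `y`. -/
def IsPair (z x y : ℕ) : Prop := z + z = (x + y) * (x + y + 1) + (y + y)

theorem exists_isPair (x y : ℕ) : ∃ z, IsPair z x y := by
  obtain ⟨m, hm⟩ := Nat.even_mul_succ_self (x + y)
  exact ⟨m + y, by unfold IsPair; omega⟩

/-- Successive codes run along the antidiagonals: `(x + 1, y)` is followed by `(x, y + 1)`, and `(0,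
y)` by the start `(y + 1, 0)` of the next antidiagonal. -/
theorem exists_unpair (z : ℕ) : ∃ x y, IsPair z x y := by
  unfold IsPair
  induction z with
  | zero => exact ⟨0, 0, rfl⟩
  | succ z ih =>
    obtain ⟨x, y, h⟩ := ih
    cases x with
    | zero => exact ⟨y + 1, 0, by linarith⟩
    | succ x => exact ⟨x, y + 1, by linarith⟩

theorem IsPair.inj {z x y x' y' : ℕ} (h : IsPair z x y) (h' : IsPair z x' y') :
    x = x' ∧ y = y' := by
  unfold IsPair at h h'
  obtain hlt | heq | hlt := lt_trichotomy (x + y) (x' + y')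
  · nlinarith
  · rw [heq] at h
    omega
  · nlinarith

theorem IsPair.le {z x y : ℕ} (h : IsPair z x y) : x ≤ z ∧ y ≤ z := by
  unfold IsPair at h
  have : x + y ≤ (x + y) * (x + y) := Nat.le_mul_self _
  constructor <;> nlinarith

/-- The order type assigned to the tree with code `n`: `0` to `∘` and `ω ^ a + b` to `∘(s, t)` if
`a` and `b` are assigned to `s` and `t`. -/
noncomputable def treeOrd : ℕ → Ordinal.{0}
  | 0 => 0
  | n + 1 =>
    ω ^ treeOrd (exists_unpair n).choose + treeOrd (exists_unpair n).choose_spec.choose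
  decreasing_by
  · exact Nat.lt_succ_of_le (exists_unpair n).choose_spec.choose_spec.le.1
  · exact Nat.lt_succ_of_le (exists_unpair n).choose_spec.choose_spec.le.2

theorem treeOrd_zero : treeOrd 0 = 0 := by rw [treeOrd]

theorem treeOrd_succ {n x y : ℕ} (h : IsPair n x y) :
    treeOrd (n + 1) = ω ^ treeOrd x + treeOrd y := by
  obtain ⟨h₁, h₂⟩ := h.inj (exists_unpair n).choose_spec.choose_spec
  rw [treeOrd]
  exact congrArg₂ (fun a b => ω ^ treeOrd a + treeOrd b) h₁.symm h₂.symm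

/-- Split off the leading Cantor normal form term, `a = ω ^ log ω a + b`. The exponent is below `a`
because no fixed point of `ω ^ ·` lies below `ε₀`. Also `b < a`, since otherwise `a` would absorb
its leading term and reach the next power of `ω`. -/
theorem exists_treeOrd_eq {a : Ordinal.{0}} (ha : a < ε₀) : ∃ t, treeOrd t = a := by
  induction a using WellFoundedLT.induction with
  | ind a ih =>
    obtain rfl | h₀ := eq_or_ne a 0
    · exact ⟨0, treeOrd_zero⟩
    have hle := opow_log_le_self ω h₀
    have hlog : log ω a < a := by
      refine lt_of_le_of_ne ((right_le_opow _ one_lt_omega0).trans hle) fun h => ?_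
      rw [h] at hle
      exact ha.not_ge (epsilon_zero_le_of_omega0_opow_le hle)
    have hsub : a - ω ^ log ω a < a := by
      refine lt_of_le_of_ne (Ordinal.sub_le_self _ _) fun h => ?_
      have h' : ω ^ log ω a + a = a := by
        nth_rw 2 [← h]
        exact Ordinal.add_sub_cancel_of_le hle
      rw [add_eq_right_iff_mul_omega0_le, ← opow_succ] at h'
      exact (lt_opow_succ_log_self one_lt_omega0 a).not_ge h'
    obtain ⟨s, hs⟩ := ih _ hlog (hlog.trans ha)
    obtain ⟨t, ht⟩ := ih _ hsub (hsub.trans ha)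
    obtain ⟨z, hz⟩ := exists_isPair s t
    exact ⟨z + 1, by rw [treeOrd_succ hz, hs, ht, Ordinal.add_sub_cancel_of_le hle]⟩

/-- A relation that is justified by the recursive clauses for the order of trees implies the order
of the assigned ordinals. -/
theorem treeOrd_le_of_verified {R : ℕ → ℕ → Prop}
    (hR : ∀ u v, R u v → u = 0 ∨ ∃ u₀ u₁ v₀ v₁, (∃ p, IsPair p u₀ u₁ ∧ u = p + 1) ∧
      (∃ p, IsPair p v₀ v₁ ∧ v = p + 1) ∧ (R u₀ v₀ ∧ R u₁ v₁ ∨ R u v₀ ∨ R u v₁))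
    {u v : ℕ} (h : R u v) : treeOrd u ≤ treeOrd v := by
  -- Every recursive clause passes to an immediate subtree of the right tree, whose code is smaller,
  -- so induction on `v` alone suffices.
  induction v using Nat.strong_induction_on generalizing u with
  | _ v ih =>
    obtain rfl | ⟨u₀, u₁, v₀, v₁, ⟨p, hp, rfl⟩, ⟨q, hq, rfl⟩, h'⟩ := hR _ _ h
    · simp [treeOrd_zero]
    have hv₀ : v₀ < q + 1 := Nat.lt_succ_of_le hq.le.1
    have hv₁ : v₁ < q + 1 := Nat.lt_succ_of_le hq.le.2
    rw [treeOrd_succ hq]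
    rcases h' with ⟨h₀, h₁⟩ | h | h
    · rw [treeOrd_succ hp]
      exact add_le_add (opow_le_opow_right omega0_pos (ih _ hv₀ h₀)) (ih _ hv₁ h₁)
    · exact (ih _ hv₀ h).trans ((right_le_opow _ one_lt_omega0).trans le_self_add)
    · exact (ih _ hv₁ h).trans le_add_self

/-! ### Infinitary propositional formulas -/

/-- Infinitary propositional formulas in negation normal form, over atoms `n ∈ X`. -/
inductive IF : Type 1
  | lit (b : Bool) (n : ℕ)
  | conj (ι : Type) (f : ι → IF)
  | disj (ι : Type) (f : ι → IF)

namespace IF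

def neg : IF → IF
  | lit b n => lit (!b) n
  | conj ι f => disj ι fun i => (f i).neg
  | disj ι f => conj ι fun i => (f i).neg

@[simp] theorem neg_neg (φ : IF) : φ.neg.neg = φ := by
  induction φ with
  | lit b n => simp [neg]
  | conj ι f ih => simp [neg, ih]
  | disj ι f ih => simp [neg, ih]

/-- The rank of `φ` is finite and at most `k`. -/
def RankLE : IF → ℕ → Prop
  | lit _ _, _ => True
  | conj _ _, 0 => False
  | disj _ _, 0 => False
  | conj _ f, k + 1 => ∀ i, (f i).RankLE k
  | disj _ f, k + 1 => ∀ i, (f i).RankLE k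

theorem RankLE.mono {φ : IF} {k m : ℕ} (h : φ.RankLE k) (hkm : k ≤ m) : φ.RankLE m := by
  induction φ generalizing k m with
  | lit b n => trivial
  | conj ι f ih | disj ι f ih =>
    cases k with
    | zero => exact h.elim
    | succ k =>
      cases m with
      | zero => omega
      | succ m => exact fun i => ih i (h i) (by omega)

theorem RankLE.neg {φ : IF} {k : ℕ} (h : φ.RankLE k) : φ.neg.RankLE k := by
  induction φ generalizing k with
  | lit b n => trivial
  | conj ι f ih | disj ι f ih =>
    cases k with
    | zero => exact h.elim
    | succ k => exact fun i => ih i (h i)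

end IF

/-! ### Infinitary derivations over finite descending sequences of trees -/

/-- The sequence of ordinals assigned to the trees is strictly descending. -/
def Descending (s : List ℕ) : Prop := s.Pairwise fun x y => treeOrd y < treeOrd x

/-- The truth value of `n ∈ X` is decided to be `b` by `s`, where `X` is the set of all pairs
`⟨i, t⟩` such that `t` is the entry with index `i` in an infinite extension of `s`. -/
def Decides (s : List ℕ) (b : Bool) (n : ℕ) : Prop :=
  ∃ i t, IsPair n i t ∧ ∃ t', s[i]? = some t' ∧ (b = true ↔ t = t')

theorem Decides.mono {s s' : List ℕ} {b : Bool} {n : ℕ} (h : Decides s b n) (hs : s <+: s') :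
    Decides s' b n := by
  obtain ⟨i, t, hn, t', ht, hb⟩ := h
  obtain ⟨u, rfl⟩ := hs
  exact ⟨i, t, hn, t', by rw [List.getElem?_append_left (List.getElem?_eq_some_iff.1 ht).1, ht], hb⟩

theorem Decides.not_neg {s : List ℕ} {b : Bool} {n : ℕ} (h : Decides s b n) :
    ¬ Decides s (!b) n := by
  rintro ⟨i₂, t₂, hn₂, t₂', ht₂, hb₂⟩
  obtain ⟨i, t, hn, t', ht, hb⟩ := h
  obtain ⟨rfl, rfl⟩ := hn.inj hn₂
  rw [ht] at ht₂
  cases ht₂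
  cases b <;> simp_all

open IF

/-- Infinitary derivations of height `α` with cuts of rank below `k`. The rule `query` extends the
finite descending sequence of trees by an unknown further entry. -/
inductive InfDerivable : Ordinal.{0} → ℕ → List ℕ → Set IF → Prop
  | lit {α k s Γ} (b : Bool) (n : ℕ) : lit b n ∈ Γ → Decides s b n → InfDerivable α k s Γ
  | conj {α β k s Γ} (ι : Type) (f : ι → IF) : conj ι f ∈ Γ → β < α →
      (∀ i, InfDerivable β k s (insert (f i) Γ)) → InfDerivable α k s Γ
  | disj {α β k s Γ} (ι : Type) (f : ι → IF) (i : ι) : disj ι f ∈ Γ → β < α →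
      InfDerivable β k s (insert (f i) Γ) → InfDerivable α k s Γ
  | cut {α β k m s Γ} (φ : IF) : φ.RankLE m → m < k → β < α →
      InfDerivable β k s (insert φ Γ) → InfDerivable β k s (insert φ.neg Γ) →
      InfDerivable α k s Γ
  | query {α β k s Γ} : β < α →
      (∀ t, Descending (s ++ [t]) → InfDerivable β k (s ++ [t]) Γ) → InfDerivable α k s Γ

/-! ### Structural rules, inversion and cut elimination -/

namespace InfDerivable

variable {α β : Ordinal.{0}} {k m : ℕ} {s s' : List ℕ} {Γ Δ : Set IF}

theorem weaken (h : InfDerivable α k s Γ) (hα : α ≤ β) (hk : k ≤ m) (hΓ : Γ ⊆ Δ) :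
    InfDerivable β m s Δ := by
  induction h generalizing β Δ with
  | lit b n h₁ h₂ => exact .lit b n (hΓ h₁) h₂
  | conj ι f h₁ h₂ _ ih =>
    exact .conj ι f (hΓ h₁) (h₂.trans_le hα) fun i => ih i le_rfl hk (Set.insert_subset_insert hΓ)
  | disj ι f i h₁ h₂ _ ih =>
    exact .disj ι f i (hΓ h₁) (h₂.trans_le hα) (ih le_rfl hk (Set.insert_subset_insert hΓ))
  | cut φ h₁ h₂ h₃ _ _ ih₁ ih₂ =>
    exact .cut φ h₁ (h₂.trans_le hk) (h₃.trans_le hα)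
      (ih₁ le_rfl hk (Set.insert_subset_insert hΓ)) (ih₂ le_rfl hk (Set.insert_subset_insert hΓ))
  | query h₁ _ ih => exact .query (h₁.trans_le hα) fun t ht => ih t ht le_rfl hk hΓ

/-- A query that `s'` already answers is replaced by the corresponding branch. -/
theorem extend (h : InfDerivable α k s Γ) (hs : s <+: s') (hs' : Descending s') :
    InfDerivable α k s' Γ := by
  induction h generalizing s' with
  | lit b n h₁ h₂ => exact .lit b n h₁ (h₂.mono hs)
  | conj ι f h₁ h₂ _ ih => exact .conj ι f h₁ h₂ fun i => ih i hs hs'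
  | disj ι f i h₁ h₂ _ ih => exact .disj ι f i h₁ h₂ (ih hs hs')
  | cut φ h₁ h₂ h₃ _ _ ih₁ ih₂ => exact .cut φ h₁ h₂ h₃ (ih₁ hs hs') (ih₂ hs hs')
  | @query α β k s Γ h₁ h₂ ih =>
    obtain ⟨u, rfl⟩ := hs
    cases u with
    | nil => simpa using .query h₁ h₂
    | cons t u =>
      have h : s ++ [t] <+: s ++ t :: u := ⟨u, by simp⟩
      exact (ih t (hs'.sublist h.sublist) h hs').weaken h₁.le le_rfl subset_rfl

/-- The inclusion `hΔ`, in place of an equation, lets the induction cope with contraction: the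
principal formula may persist in the premises. -/
theorem conj_inversion {ι : Type} {f : ι → IF} (h : InfDerivable α k s Δ)
    (hΔ : Δ ⊆ insert (.conj ι f) Γ) (i : ι) : InfDerivable α k s (insert (f i) Γ) := by
  have key : ∀ {Δ Γ : Set IF} (φ : IF), Δ ⊆ insert (.conj ι f) Γ →
      insert φ Δ ⊆ insert (.conj ι f) (insert φ Γ) := fun φ h =>
    (Set.insert_subset_insert h).trans (Set.insert_comm _ _ _).subset
  have comm : ∀ {α k s Γ} (φ : IF), InfDerivable α k s (insert (f i) (insert φ Γ)) →
      InfDerivable α k s (insert φ (insert (f i) Γ)) := fun φ h =>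
    h.weaken le_rfl le_rfl (Set.insert_comm _ _ _).subset
  induction h generalizing Γ with
  | lit b n h₁ h₂ =>
    obtain h | h := hΔ h₁
    · cases h
    · exact .lit b n (Or.inr h) h₂
  | conj κ g h₁ h₂ _ ih =>
    obtain h | h := hΔ h₁
    · cases h
      exact (ih i (key _ hΔ)).weaken h₂.le le_rfl (by simp)
    · exact .conj κ g (Or.inr h) h₂ fun j => comm _ (ih j (key _ hΔ))
  | disj κ g j h₁ h₂ _ ih =>
    obtain h | h := hΔ h₁
    · cases h
    · exact .disj κ g j (Or.inr h) h₂ (comm _ (ih (key _ hΔ)))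
  | cut φ h₁ h₂ h₃ _ _ ih₁ ih₂ =>
    exact .cut φ h₁ h₂ h₃ (comm _ (ih₁ (key _ hΔ))) (comm _ (ih₂ (key _ hΔ)))
  | query h₁ _ ih => exact .query h₁ fun t ht => ih t ht hΔ

/-- A literal that `s` decides to be false stays false in all extensions of `s`, so no axiom of the
derivation can rest on it. -/
theorem lit_elim {b : Bool} {n : ℕ} (h : InfDerivable α k s Δ) (hs : Decides s (!b) n)
    (hΔ : Δ ⊆ insert (.lit b n) Γ) : InfDerivable α k s Γ := by
  have key : ∀ {Δ Γ : Set IF} (φ : IF), Δ ⊆ insert (.lit b n) Γ →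
      insert φ Δ ⊆ insert (.lit b n) (insert φ Γ) := fun φ h =>
    (Set.insert_subset_insert h).trans (Set.insert_comm _ _ _).subset
  induction h generalizing Γ with
  | lit c m h₁ h₂ =>
    obtain h | h := hΔ h₁
    · cases h
      exact (h₂.not_neg hs).elim
    · exact .lit c m h h₂
  | conj κ g h₁ h₂ _ ih =>
    obtain h | h := hΔ h₁
    · cases h
    · exact .conj κ g h h₂ fun j => ih j hs (key _ hΔ)
  | disj κ g j h₁ h₂ _ ih =>
    obtain h | h := hΔ h₁
    · cases h
    · exact .disj κ g j h h₂ (ih hs (key _ hΔ))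
  | cut φ h₁ h₂ h₃ _ _ ih₁ ih₂ =>
    exact .cut φ h₁ h₂ h₃ (ih₁ hs (key _ hΔ)) (ih₂ hs (key _ hΔ))
  | query h₁ _ ih => exact .query h₁ fun t ht => ih t ht (hs.mono (List.prefix_append _ _)) hΔ

/-- Two derivations can be combined by a cut of rank `k`; here `φ` is not a disjunction. -/
theorem reduction {φ : IF} (hφ : ∀ ι f, φ ≠ .disj ι f) (hr : φ.RankLE k)
    (h : InfDerivable β k s Δ) (hs : Descending s) (hΔ : Δ ⊆ insert φ.neg Γ)
    (h' : InfDerivable α k s (insert φ Γ)) : InfDerivable (α + β) k s Γ := by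
  have key : ∀ {Δ Γ : Set IF} (ψ : IF), Δ ⊆ insert φ.neg Γ →
      insert ψ Δ ⊆ insert φ.neg (insert ψ Γ) := fun φ h =>
    (Set.insert_subset_insert h).trans (Set.insert_comm _ _ _).subset
  have side : ∀ {α k s Γ} (ψ : IF), InfDerivable α k s (insert φ Γ) →
      InfDerivable α k s (insert φ (insert ψ Γ)) := fun ψ h =>
    h.weaken le_rfl le_rfl (Set.insert_subset_insert (Set.subset_insert _ _))
  induction h generalizing Γ with
  | lit c m h₁ h₂ =>
    obtain h | h := hΔ h₁
    · cases φ with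
      | lit b n =>
        cases h
        exact (h'.lit_elim h₂ subset_rfl).weaken le_self_add le_rfl subset_rfl
      | conj => cases h
      | disj ι f => exact (hφ ι f rfl).elim
    · exact .lit c m h h₂
  | conj κ g h₁ h₂ _ ih =>
    obtain h | h := hΔ h₁
    · cases φ with
      | lit => cases h
      | conj => cases h
      | disj ι f => exact (hφ ι f rfl).elim
    · exact .conj κ g h (add_lt_add_right h₂ α) fun j => ih j hr hs (key _ hΔ) (side _ h')
  | @disj β γ k s Δ κ g j h₁ h₂ _ ih =>
    obtain h | h := hΔ h₁
    · cases φ with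
      | lit => cases h
      | disj ι f => exact (hφ ι f rfl).elim
      | conj ι f =>
        cases h
        cases k with
        | zero => exact hr.elim
        | succ k =>
          -- Both cut formulas are principal: the cut moves to the component `f j`, whose smaller
          -- rank is admissible, and inversion supplies the other premise.
          refine .cut (f j) (hr j) (Nat.lt_succ_self k) (add_lt_add_right h₂ α) ?_
            (ih hr hs (key _ hΔ) (side _ h'))
          exact (h'.conj_inversion subset_rfl j).weaken le_self_add le_rfl subset_rfl
    · exact .disj κ g j h (add_lt_add_right h₂ α) (ih hr hs (key _ hΔ) (side _ h'))
  | cut φ h₁ h₂ h₃ _ _ ih₁ ih₂ =>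
    exact .cut φ h₁ h₂ (add_lt_add_right h₃ α) (ih₁ hr hs (key _ hΔ) (side _ h'))
      (ih₂ hr hs (key _ hΔ) (side _ h'))
  | query h₁ _ ih =>
    exact .query (add_lt_add_right h₁ α) fun t ht =>
      ih t ht hr ht hΔ (h'.extend (List.prefix_append _ _) ht)

/-- A formula or its negation is not a disjunction, so `reduction` applies after possibly exchanging
the premises. -/
theorem cut_reduction {φ : IF} (hr : φ.RankLE k) (hs : Descending s)
    (h₁ : InfDerivable α k s (insert φ Γ)) (h₂ : InfDerivable α k s (insert φ.neg Γ)) :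
    InfDerivable (α + α) k s Γ := by
  cases φ with
  | disj ι f =>
    exact reduction (φ := (IF.disj ι f).neg) (fun _ _ h => by cases h) hr.neg h₁ hs
      (by rw [neg_neg]) h₂
  | lit | conj => exact reduction (fun _ _ h => by cases h) hr h₂ hs subset_rfl h₁

/-- Replacing a cut adds up the heights of its premises, and powers of `ω` are closed under addition
from below: `ω ^ β + ω ^ β < ω ^ α` for `β < α`. -/
theorem cut_elim_succ (h : InfDerivable α (k + 1) s Γ) (hs : Descending s) :
    InfDerivable (ω ^ α) k s Γ := by
  have key : ∀ {α β : Ordinal.{0}}, β < α → ω ^ β < ω ^ α := fun h =>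
    (opow_lt_opow_iff_right one_lt_omega0).2 h
  generalize hm : k + 1 = m at h
  induction h with
  | lit b n h₁ h₂ => exact .lit b n h₁ h₂
  | conj ι f h₁ h₂ _ ih => exact .conj ι f h₁ (key h₂) fun i => ih i hs hm
  | disj ι f i h₁ h₂ _ ih => exact .disj ι f i h₁ (key h₂) (ih hs hm)
  | cut φ h₁ h₂ h₃ _ _ ih₁ ih₂ =>
    exact (cut_reduction (h₁.mono (by omega)) hs (ih₁ hs hm) (ih₂ hs hm)).weaken
      (isPrincipal_add_omega0_opow _ (key h₃) (key h₃)).le le_rfl subset_rfl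
  | query h₁ _ ih => exact .query (key h₁) fun t ht => ih t ht ht hm

theorem omega0_opow_lt_epsilon_zero (h : α < ε₀) : ω ^ α < ε₀ := by
  rw [← omega0_opow_epsilon 0]
  exact (opow_lt_opow_iff_right one_lt_omega0).2 h

theorem cut_elim (h : InfDerivable α k s Γ) (hs : Descending s) (hα : α < ε₀) :
    ∃ β < ε₀, InfDerivable β 0 s Γ := by
  induction k generalizing α with
  | zero => exact ⟨α, hα, h⟩
  | succ k ih => exact ih (h.cut_elim_succ hs) (omega0_opow_lt_epsilon_zero hα)

/-- Only a query can end such a derivation. It is answered by a tree with ordinal `β`, the height of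
the premise; as `β < α` and all earlier entries have ordinals at least `α`, the sequence stays
descending and the invariant `hsα` is preserved. -/
theorem not_empty_of_cut_free (h : InfDerivable α 0 s Γ) (hΓ : Γ = ∅) (hα : α < ε₀)
    (hs : Descending s) (hsα : ∀ t ∈ s, α ≤ treeOrd t) : False := by
  generalize hk : 0 = k at h
  induction h with
  | lit b n h₁ | conj _ _ h₁ | disj _ _ _ h₁ => simp [hΓ] at h₁
  | cut φ _ h₂ => omega
  | @query α β k s Γ h₁ _ ih =>
    obtain ⟨t, ht⟩ := exists_treeOrd_eq (h₁.trans hα)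
    refine ih t ?_ hΓ (h₁.trans hα) ?_ ?_ hk
    · exact List.pairwise_append.2 ⟨hs, by simp, by simpa [ht] using fun x hx => h₁.trans_le (hsα x hx)⟩
    · exact List.pairwise_append.2 ⟨hs, by simp, by simpa [ht] using fun x hx => h₁.trans_le (hsα x hx)⟩
    · intro x hx
      obtain hx | hx := List.mem_append.1 hx
      · exact h₁.le.trans (hsα x hx)
      · rw [List.mem_singleton.1 hx, ht]

theorem not_empty (h : InfDerivable α k [] ∅) (hα : α < ε₀) : False := by
  obtain ⟨β, hβ, h⟩ := h.cut_elim List.Pairwise.nil hα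
  exact h.not_empty_of_cut_free rfl hβ List.Pairwise.nil (by simp)

end InfDerivable

/-! ### Provability of families of sequents -/

namespace InfDerivable

variable {α β : Ordinal.{0}} {k m : ℕ} {s : List ℕ} {Γ : Set IF}

/-- At the cost of `d` in height, one may assume that the sequence has length at least `m`. -/
theorem query_until (hs : Descending s) {d : ℕ} (hd : m ≤ s.length + d)
    (h : ∀ s', s <+: s' → Descending s' → m ≤ s'.length → InfDerivable β k s' Γ) :
    InfDerivable (β + d) k s Γ := by
  induction d generalizing s with
  | zero => simpa using h s (List.prefix_refl s) hs hd
  | succ d ih =>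
    refine .query (β := β + d) (by simp) fun t ht => ih ht ?_ fun s' hs' => ?_
    · simp only [List.length_append, List.length_singleton]
      omega
    · exact h s' ((List.prefix_append _ _).trans hs')

theorem exists_decides (n : ℕ) :
    ∃ m, ∀ s : List ℕ, m ≤ s.length → ∃ b, Decides s b n := by
  obtain ⟨i, t, hn⟩ := exists_unpair n
  refine ⟨i + 1, fun s hs => ?_⟩
  obtain h | h := eq_or_ne t s[i]
  · exact ⟨true, i, t, hn, s[i], List.getElem?_eq_getElem _, by simpa using h⟩
  · exact ⟨false, i, t, hn, s[i], List.getElem?_eq_getElem _, by simpa using h⟩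

/-- Deciding an atom takes finitely many queries, with no common bound for all atoms, hence the
summand `ω`. Each level of rank then costs two inferences. -/
theorem excluded_middle {φ : IF} (hr : φ.RankLE m) (hs : Descending s) (h : φ ∈ Γ)
    (h' : φ.neg ∈ Γ) : InfDerivable (ω + (m * 2 : ℕ)) k s Γ := by
  have lt : ∀ m : ℕ, ω + (m * 2 : ℕ) < ω + (m * 2 + 1 : ℕ) := fun m =>
    add_lt_add_right (by exact_mod_cast Nat.lt_succ_self _) _
  have lt' : ∀ m : ℕ, ω + (m * 2 + 1 : ℕ) < ω + ((m + 1) * 2 : ℕ) := fun m =>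
    add_lt_add_right (by norm_cast; omega) _
  induction φ generalizing m Γ with
  | lit b n =>
    obtain ⟨d, hd⟩ := exists_decides n
    refine (query_until (β := 0) hs (m := d) (d := d) (by omega) fun s' _ _ hs' => ?_).weaken
      (by simpa using (natCast_lt_omega0 d).le.trans le_self_add) le_rfl subset_rfl
    obtain ⟨c, hc⟩ := hd s' hs'
    obtain rfl | rfl := Bool.eq_or_eq_not c b
    · exact .lit _ n h hc
    · exact .lit _ n h' hc
  | conj ι f ih =>
    cases m with
    | zero => exact hr.elim
    | succ m =>
      exact .conj ι f h (lt' m) fun i => .disj ι _ i (Or.inr h') (lt m)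
        (ih i (hr i) (by simp) (by simp))
  | disj ι f ih =>
    cases m with
    | zero => exact hr.elim
    | succ m =>
      exact .conj ι _ h' (lt' m) fun i => .disj ι f i (Or.inr h) (lt m)
        (ih i (hr i) (by simp) (by simp))

end InfDerivable

theorem add_lt_epsilon_zero {α β : Ordinal.{0}} (hα : α < ε₀) (hβ : β < ε₀) : α + β < ε₀ := by
  have h := isPrincipal_add_omega0_opow (ε₀ : Ordinal.{0})
  rw [omega0_opow_epsilon] at h
  exact h hα hβ

theorem add_natCast_lt_epsilon_zero {α : Ordinal.{0}} (hα : α < ε₀) (n : ℕ) : α + n < ε₀ :=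
  add_lt_epsilon_zero hα (natCast_lt_epsilon n 0)

/-- The sequents of the family are derivable with uniform bounds on heights and cut ranks. -/
def Prov {I : Type} (Γ : I → Set IF) : Prop :=
  ∃ α < ε₀, ∃ k, ∀ i, InfDerivable α k [] (Γ i)

namespace Prov

variable {I J : Type} {Γ : I → Set IF}

theorem weaken {Δ : J → Set IF} (h : Prov Γ) (π : J → I) (hπ : ∀ j, Γ (π j) ⊆ Δ j) :
    Prov Δ := by
  obtain ⟨α, hα, k, h⟩ := h
  exact ⟨α, hα, k, fun j => (h _).weaken le_rfl le_rfl (hπ j)⟩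

theorem cut {P : I → IF} {k : ℕ} (hP : ∀ i, (P i).RankLE k)
    (h₁ : Prov fun i => insert (P i) (Γ i)) (h₂ : Prov fun i => insert (P i).neg (Γ i)) :
    Prov Γ := by
  obtain ⟨α, hα, m, h₁⟩ := h₁
  obtain ⟨β, hβ, n, h₂⟩ := h₂
  refine ⟨max α β + 1, by simpa using add_natCast_lt_epsilon_zero (max_lt hα hβ) 1,
    max (max m n) (k + 1), fun i => ?_⟩
  refine .cut (P i) (hP i) (lt_max_of_lt_right (Nat.lt_succ_self k)) (lt_add_one (max α β))
    ((h₁ i).weaken (le_max_left _ _) ?_ subset_rfl) ((h₂ i).weaken (le_max_right _ _) ?_ subset_rfl)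
  · exact (le_max_left _ _).trans (le_max_left _ _)
  · exact (le_max_right _ _).trans (le_max_left _ _)

theorem excluded_middle {P : I → IF} {k : ℕ} (hP : ∀ i, (P i).RankLE k) (h : ∀ i, P i ∈ Γ i)
    (h' : ∀ i, (P i).neg ∈ Γ i) : Prov Γ :=
  ⟨_, add_natCast_lt_epsilon_zero (omega0_lt_epsilon 0) (k * 2), 0, fun i =>
    .excluded_middle (hP i) List.Pairwise.nil (h i) (h' i)⟩

/-- The premises of all these infinitary inferences form one family over `I × ι`, which is how they
come to share a bound below `ε₀`. -/
theorem conj {ι : Type} {f : I → ι → IF}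
    (h : Prov fun p : I × ι => insert (f p.1 p.2) (Γ p.1)) :
    Prov fun i => insert (.conj ι (f i)) (Γ i) := by
  obtain ⟨α, hα, k, h⟩ := h
  refine ⟨α + 1, by simpa using add_natCast_lt_epsilon_zero hα 1, k, fun i => ?_⟩
  exact .conj ι (f i) (by simp) (lt_add_one α) fun x => (h (i, x)).weaken le_rfl le_rfl
    (Set.insert_subset_insert (Set.subset_insert _ _))

theorem conj_inversion {ι : Type} {f : I → ι → IF}
    (h : Prov fun i => insert (.conj ι (f i)) (Γ i)) (a : I → ι) :
    Prov fun i => insert (f i (a i)) (Γ i) := by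
  obtain ⟨α, hα, k, h⟩ := h
  exact ⟨α, hα, k, fun i => (h i).conj_inversion subset_rfl (a i)⟩

theorem disj {ι : Type} {f : I → ι → IF} (a : I → ι)
    (h : Prov fun i => insert (f i (a i)) (Γ i)) :
    Prov fun i => insert (.disj ι (f i)) (Γ i) := by
  obtain ⟨α, hα, k, h⟩ := h
  refine ⟨α + 1, by simpa using add_natCast_lt_epsilon_zero hα 1, k, fun i => ?_⟩
  exact .disj ι (f i) (a i) (by simp) (lt_add_one α) ((h i).weaken le_rfl le_rfl
    (Set.insert_subset_insert (Set.subset_insert _ _)))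

theorem and {P Q : I → IF} (h₁ : Prov fun i => insert (P i) (Γ i))
    (h₂ : Prov fun i => insert (Q i) (Γ i)) :
    Prov fun i => insert (.conj Bool fun b => cond b (P i) (Q i)) (Γ i) := by
  refine conj ?_
  obtain ⟨⟨α, hα, k, h₁⟩, β, hβ, m, h₂⟩ := And.intro h₁ h₂
  refine ⟨max α β, max_lt hα hβ, max k m, fun ⟨i, b⟩ => ?_⟩
  cases b
  · exact (h₂ i).weaken (le_max_right _ _) (le_max_right _ _) subset_rfl
  · exact (h₁ i).weaken (le_max_left _ _) (le_max_left _ _) subset_rfl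

theorem or {P Q : I → IF} (h : Prov fun i => insert (P i) (insert (Q i) (Γ i))) :
    Prov fun i => insert (.disj Bool fun b => cond b (P i) (Q i)) (Γ i) := by
  have h' : Prov fun i => insert (Q i) (insert (.disj Bool fun b => cond b (P i) (Q i)) (Γ i)) :=
    (h.disj (f := fun i b => cond b (P i) (Q i)) fun _ => true).weaken id
      fun _ => (Set.insert_comm _ _ _).subset
  exact (h'.disj (f := fun i b => cond b (P i) (Q i)) fun _ => false).weaken id
    fun _ => by simp

end Prov

/-! ### Substitution -/

/-- The sequence `a, f 0, f 1, …` -/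
def scons {A : Type*} (a : A) (f : ℕ → A) : ℕ → A
  | 0 => a
  | n + 1 => f n

@[simp] theorem scons_zero {A : Type*} (a : A) (f : ℕ → A) : scons a f 0 = a := rfl

@[simp] theorem scons_succ {A : Type*} (a : A) (f : ℕ → A) (n : ℕ) : scons a f (n + 1) = f n := rfl

def Term.val (e : ℕ → ℕ) : Term → ℕ
  | .var i => e i
  | .zero => 0
  | .succ t => t.val e + 1
  | .add s t => s.val e + t.val e
  | .mul s t => s.val e * t.val e

theorem Term.val_subst (e : ℕ → ℕ) (σ : ℕ → Term) (t : Term) :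
    (t.subst σ).val e = t.val fun i => (σ i).val e := by
  induction t <;> simp [Term.subst, Term.val, *]

theorem Term.val_lift (e : ℕ → ℕ) (k : ℕ) (t : Term) :
    (t.lift k).val e = t.val fun i => e (i + k) :=
  t.val_subst _ _

theorem val_liftTerms (a : ℕ) (e : ℕ → ℕ) (σ : ℕ → Term) :
    (fun n => (liftTerms σ n).val (scons a e)) = scons a fun n => (σ n).val e := by
  funext n
  cases n with
  | zero => rfl
  | succ n => exact Term.val_lift _ _ _

theorem scons_liftSets {A : Type*} (a : A) (f : ℕ → A) (τ : ℕ → ℕ) :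
    (fun j => scons a f (liftSets τ j)) = scons a fun j => f (τ j) := by
  funext n
  cases n <;> rfl

theorem val_liftTerms_family {I : Type} (a : I → ℕ) (e : I → ℕ → ℕ) (σ : ℕ → Term) :
    (fun i n => (liftTerms σ n).val (scons (a i) (e i))) =
      fun i => scons (a i) fun n => (σ n).val (e i) :=
  funext fun _ => val_liftTerms _ _ _

theorem scons_liftSets_family {I : Type} {A : Type*} (a : I → A) (f : I → ℕ → A) (τ : ℕ → ℕ) :
    (fun i j => scons (a i) (f i) (liftSets τ j)) = fun i => scons (a i) fun j => f i (τ j) :=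
  funext fun _ => scons_liftSets _ _ _

namespace Formula

theorem not_not (φ : Formula) : φ.not.not = φ := by
  induction φ <;> simp [Formula.not, *]

theorem not_subst (φ : Formula) (σ : ℕ → Term) (τ : ℕ → ℕ) :
    (φ.subst σ τ).not = φ.not.subst σ τ := by
  induction φ generalizing σ τ <;> simp [Formula.not, Formula.subst, *]

theorem not_exs (n : ℕ) (φ : Formula) : (exs n φ).not = alls n φ.not := by
  induction n with
  | zero => rfl
  | succ n ih => simp [alls, exs, Formula.not, ih]

theorem IsArithmetical.subst {φ : Formula} (h : φ.IsArithmetical) (σ : ℕ → Term) (τ : ℕ → ℕ) :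
    (φ.subst σ τ).IsArithmetical := by
  induction φ generalizing σ τ with
  | pos | neg => trivial
  | and φ ψ ih₁ ih₂ | or φ ψ ih₁ ih₂ => exact ⟨ih₁ h.1 σ τ, ih₂ h.2 σ τ⟩
  | all φ ih | ex φ ih => exact ih h _ τ
  | allSet | exSet => exact h.elim

theorem IsArithmetical.not {φ : Formula} (h : φ.IsArithmetical) : φ.not.IsArithmetical := by
  induction φ with
  | pos | neg => trivial
  | and φ ψ ih₁ ih₂ | or φ ψ ih₁ ih₂ => exact ⟨ih₁ h.1, ih₂ h.2⟩
  | all φ ih | ex φ ih => exact ih h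
  | allSet | exSet => exact h.elim

end Formula

/-! ### Translation of arithmetical formulas -/

open Classical in
/-- The truth value of `p` as a formula without atoms. -/
noncomputable def IF.ofProp (p : Prop) : IF :=
  if p then .conj Empty Empty.elim else .disj Empty Empty.elim

theorem IF.neg_ofProp (p : Prop) : (ofProp p).neg = ofProp (¬ p) := by
  by_cases h : p
  · simp only [ofProp, h, neg, if_true, not_true, if_false, IF.disj.injEq, true_and, heq_eq_eq]
    exact funext fun i => i.elim
  · simp only [ofProp, h, neg, if_true, not_false_eq_true, if_false, IF.conj.injEq, true_and,
      heq_eq_eq]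
    exact funext fun i => i.elim

theorem IF.rankLE_ofProp (p : Prop) : (ofProp p).RankLE 1 := by
  unfold ofProp
  split <;> exact fun i => i.elim

/-- The translation of a prime formula, for values of the number variables and propositional
formulas `S j n` that stand for `n ∈ X`, where `X` is the set variable with index `j`. -/
noncomputable def Atom.tr (e : ℕ → ℕ) (S : ℕ → ℕ → IF) : Atom → IF
  | .eq s t => ofProp (s.val e = t.val e)
  | .le s t => ofProp (s.val e ≤ t.val e)
  | .mem t j => S j (t.val e)

/-- The translation of an arithmetical formula; set quantifiers get a dummy value. -/
noncomputable def Formula.tr : Formula → (ℕ → ℕ) → (ℕ → ℕ → IF) → IF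
  | .pos a, e, S => a.tr e S
  | .neg a, e, S => (a.tr e S).neg
  | .and φ ψ, e, S => .conj Bool fun b => cond b (φ.tr e S) (ψ.tr e S)
  | .or φ ψ, e, S => .disj Bool fun b => cond b (φ.tr e S) (ψ.tr e S)
  | .all φ, e, S => .conj ℕ fun n => φ.tr (scons n e) S
  | .ex φ, e, S => .disj ℕ fun n => φ.tr (scons n e) S
  | .allSet _, _, _ => ofProp True
  | .exSet _, _, _ => ofProp False

theorem Atom.tr_subst (a : Atom) (σ : ℕ → Term) (τ : ℕ → ℕ) (e : ℕ → ℕ) (S : ℕ → ℕ → IF) :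
    (a.subst σ τ).tr e S = a.tr (fun i => (σ i).val e) fun j => S (τ j) := by
  cases a <;> simp [Atom.subst, Atom.tr, Term.val_subst]

namespace Formula

theorem tr_subst (φ : Formula) (σ : ℕ → Term) (τ : ℕ → ℕ) (e : ℕ → ℕ) (S : ℕ → ℕ → IF) :
    (φ.subst σ τ).tr e S = φ.tr (fun i => (σ i).val e) fun j => S (τ j) := by
  induction φ generalizing σ τ e S with
  | pos | neg => simp [Formula.subst, tr, Atom.tr_subst]
  | and φ ψ ih₁ ih₂ | or φ ψ ih₁ ih₂ => simp [Formula.subst, tr, ih₁, ih₂]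
  | all φ ih | ex φ ih => simp [Formula.subst, tr, ih, val_liftTerms]
  | allSet | exSet => rfl

theorem tr_not (φ : Formula) (e : ℕ → ℕ) (S : ℕ → ℕ → IF) : φ.not.tr e S = (φ.tr e S).neg := by
  induction φ generalizing e with
  | pos | neg => simp [Formula.not, tr]
  | and φ ψ ih₁ ih₂ | or φ ψ ih₁ ih₂ =>
    simp only [Formula.not, tr, IF.neg, ih₁, ih₂]
    congr 1
    funext b
    cases b <;> rfl
  | all φ ih | ex φ ih => simp [Formula.not, tr, IF.neg, ih]
  | allSet | exSet => simp [Formula.not, tr, IF.neg_ofProp]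

end Formula

/-- For each set variable, the ranks of the assigned propositional formulas are bounded. -/
def BoundedSets {I : Type} (S : I → ℕ → ℕ → IF) : Prop :=
  ∀ j, ∃ k, ∀ i n, (S i j n).RankLE k

theorem BoundedSets.comp {I J : Type} {S : I → ℕ → ℕ → IF} (hS : BoundedSets S) (π : J → I) :
    BoundedSets fun j => S (π j) := fun j =>
  let ⟨k, h⟩ := hS j
  ⟨k, fun i => h (π i)⟩

theorem BoundedSets.scons {I : Type} {S : I → ℕ → ℕ → IF} (hS : BoundedSets S) {A : I → ℕ → IF}
    {k : ℕ} (hA : ∀ i n, (A i n).RankLE k) : BoundedSets fun i => scons (A i) (S i)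
  | 0 => ⟨k, hA⟩
  | j + 1 => hS j

theorem Formula.exists_rankLE_tr (φ : Formula) {I : Type} {S : I → ℕ → ℕ → IF}
    (hS : BoundedSets S) : ∃ k, ∀ i e, (φ.tr e (S i)).RankLE k := by
  have atom : ∀ a : Atom, ∃ k, ∀ i e, (a.tr e (S i)).RankLE k := by
    rintro (⟨s, t⟩ | ⟨s, t⟩ | ⟨t, j⟩)
    · exact ⟨1, fun _ _ => rankLE_ofProp _⟩
    · exact ⟨1, fun _ _ => rankLE_ofProp _⟩
    · exact (hS j).imp fun k h i e => h i _
  induction φ with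
  | pos a => exact atom a
  | neg a => exact (atom a).imp fun k h i e => (h i e).neg
  | and φ ψ ih₁ ih₂ | or φ ψ ih₁ ih₂ =>
    obtain ⟨k, hk⟩ := ih₁
    obtain ⟨m, hm⟩ := ih₂
    refine ⟨max k m + 1, fun i e b => ?_⟩
    cases b
    · exact (hm i e).mono (le_max_right _ _)
    · exact (hk i e).mono (le_max_left _ _)
  | all φ ih | ex φ ih =>
    obtain ⟨k, hk⟩ := ih
    exact ⟨k + 1, fun i e n => hk i _⟩
  | allSet | exSet => exact ⟨1, fun _ _ => rankLE_ofProp _⟩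

/-! ### Forcing -/

/-- Forcing for formulas of second order arithmetic. A condition is a family `Γ` of sequents, which
says that all formulas in `Γ i` are refuted. It is consistent if the family is not derivable. The
condition `Δ` extends `Γ` along `π` if `Γ (π j) ⊆ Δ j` for all `j`. -/
def Forces : Formula → (I : Type) → (I → Set IF) → (I → ℕ → ℕ) → (I → ℕ → ℕ → IF) → Prop
  | .pos a, _, Γ, e, S => Prov fun i => insert (a.tr (e i) (S i)) (Γ i)
  | .neg a, _, Γ, e, S => Prov fun i => insert (a.tr (e i) (S i)).neg (Γ i)
  | .and φ ψ, I, Γ, e, S => Forces φ I Γ e S ∧ Forces ψ I Γ e S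
  | .or φ ψ, I, Γ, e, S => ∀ (J : Type) (Δ : J → Set IF) (π : J → I), (∀ j, Γ (π j) ⊆ Δ j) →
      ¬ Prov Δ → ∃ (K : Type) (Θ : K → Set IF) (ρ : K → J), (∀ k, Δ (ρ k) ⊆ Θ k) ∧ ¬ Prov Θ ∧
        (Forces φ K Θ (fun k => e (π (ρ k))) (fun k => S (π (ρ k))) ∨
          Forces ψ K Θ (fun k => e (π (ρ k))) (fun k => S (π (ρ k))))
  | .all φ, I, Γ, e, S => ∀ (J : Type) (Δ : J → Set IF) (π : J → I), (∀ j, Γ (π j) ⊆ Δ j) →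
      ∀ a : J → ℕ, Forces φ J Δ (fun j => scons (a j) (e (π j))) (fun j => S (π j))
  | .ex φ, I, Γ, e, S => ∀ (J : Type) (Δ : J → Set IF) (π : J → I), (∀ j, Γ (π j) ⊆ Δ j) →
      ¬ Prov Δ → ∃ (K : Type) (Θ : K → Set IF) (ρ : K → J), (∀ k, Δ (ρ k) ⊆ Θ k) ∧ ¬ Prov Θ ∧
        ∃ a : K → ℕ, Forces φ K Θ (fun k => scons (a k) (e (π (ρ k)))) (fun k => S (π (ρ k)))
  | .allSet φ, I, Γ, e, S => ∀ (J : Type) (Δ : J → Set IF) (π : J → I), (∀ j, Γ (π j) ⊆ Δ j) →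
      ∀ A : J → ℕ → IF, (∃ m, ∀ j n, (A j n).RankLE m) →
        Forces φ J Δ (fun j => e (π j)) (fun j => scons (A j) (S (π j)))
  | .exSet φ, I, Γ, e, S => ∀ (J : Type) (Δ : J → Set IF) (π : J → I), (∀ j, Γ (π j) ⊆ Δ j) →
      ¬ Prov Δ → ∃ (K : Type) (Θ : K → Set IF) (ρ : K → J), (∀ k, Δ (ρ k) ⊆ Θ k) ∧ ¬ Prov Θ ∧
        ∃ A : K → ℕ → IF, (∃ m, ∀ j n, (A j n).RankLE m) ∧
          Forces φ K Θ (fun k => e (π (ρ k))) (fun k => scons (A k) (S (π (ρ k))))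

namespace Forces

variable {I J : Type} {Γ : I → Set IF} {e : I → ℕ → ℕ} {S : I → ℕ → ℕ → IF} {φ ψ : Formula}

theorem mono {Δ : J → Set IF} (h : Forces φ I Γ e S) (π : J → I) (hπ : ∀ j, Γ (π j) ⊆ Δ j) :
    Forces φ J Δ (fun j => e (π j)) (fun j => S (π j)) := by
  induction φ generalizing J with
  | pos | neg => exact Prov.weaken h π fun j => Set.insert_subset_insert (hπ j)
  | and φ ψ ih₁ ih₂ => exact ⟨ih₁ h.1 π hπ, ih₂ h.2 π hπ⟩
  | or | all | ex | allSet | exSet =>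
    exact fun K Θ ρ hρ => h K Θ (fun k => π (ρ k)) fun k => (hπ _).trans (hρ k)

theorem subst_iff (φ : Formula) {I : Type} (Γ : I → Set IF) (e : I → ℕ → ℕ) (S : I → ℕ → ℕ → IF)
    (σ : ℕ → Term) (τ : ℕ → ℕ) :
    Forces (φ.subst σ τ) I Γ e S ↔
      Forces φ I Γ (fun i n => (σ n).val (e i)) fun i j => S i (τ j) := by
  induction φ generalizing I σ τ <;>
    simp only [Formula.subst, Forces, Atom.tr_subst, val_liftTerms_family, scons_liftSets_family, *]

/-- `φ` is forced by each condition that has no consistent extension forcing `¬φ`. -/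
def Stable (φ : Formula) : Prop :=
  ∀ (I : Type) (Γ : I → Set IF) (e : I → ℕ → ℕ) (S : I → ℕ → ℕ → IF), BoundedSets S →
    (∀ (J : Type) (Δ : J → Set IF) (π : J → I), (∀ j, Γ (π j) ⊆ Δ j) → ¬ Prov Δ →
      ¬ Forces φ.not J Δ (fun j => e (π j)) fun j => S (π j)) → Forces φ I Γ e S

/-! ### Stability, one connective at a time -/

/-- If the atom is not forced, then adding it to the sequents gives a consistent extension, and this
forces the negated atom by excluded middle. -/
theorem stable_pos (a : Atom) : Stable (.pos a) := by
  intro I Γ e S hS h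
  by_contra hn
  obtain ⟨k, hk⟩ := (Formula.pos a).exists_rankLE_tr hS
  exact h I _ id (fun i => Set.subset_insert _ _) hn
    (Prov.excluded_middle (fun i => hk i (e i)) (by simp [Formula.tr]) (by simp [Formula.tr]))

theorem stable_neg (a : Atom) : Stable (.neg a) := by
  intro I Γ e S hS h
  by_contra hn
  obtain ⟨k, hk⟩ := (Formula.pos a).exists_rankLE_tr hS
  exact h I _ id (fun i => Set.subset_insert _ _) hn
    (Prov.excluded_middle (fun i => hk i (e i)) (by simp [Formula.tr]) (by simp [Formula.tr]))

theorem stable_and (hφ : Stable φ) (hψ : Stable ψ) : Stable (.and φ ψ) := by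
  refine fun I Γ e S hS h => ⟨hφ I Γ e S hS fun J Δ π hπ hΔ h' => h J Δ π hπ hΔ ?_,
    hψ I Γ e S hS fun J Δ π hπ hΔ h' => h J Δ π hπ hΔ ?_⟩
  · exact fun K Θ ρ hρ hΘ => ⟨K, Θ, id, fun _ => subset_rfl, hΘ, Or.inl (h'.mono ρ hρ)⟩
  · exact fun K Θ ρ hρ hΘ => ⟨K, Θ, id, fun _ => subset_rfl, hΘ, Or.inr (h'.mono ρ hρ)⟩

theorem stable_or (hφ : Stable φ.not) (hψ : Stable ψ.not) : Stable (.or φ ψ) := by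
  intro I Γ e S hS h J Δ π hπ hΔ
  by_contra hn
  refine h J Δ π hπ hΔ ⟨hφ J Δ _ _ (hS.comp π) ?_, hψ J Δ _ _ (hS.comp π) ?_⟩ <;>
    rw [Formula.not_not] <;> refine fun K Θ ρ hρ hΘ h' => hn ⟨K, Θ, ρ, hρ, hΘ, ?_⟩
  exacts [Or.inl h', Or.inr h']

theorem stable_all (hφ : Stable φ) : Stable (.all φ) := by
  refine fun I Γ e S hS h J Δ π hπ a => hφ J Δ _ _ (hS.comp π) fun K Θ ρ hρ hΘ h' => ?_
  refine h K Θ (fun k => π (ρ k)) (fun k => (hπ _).trans (hρ k)) hΘ fun L Λ η hη hΛ => ?_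
  exact ⟨L, Λ, id, fun _ => subset_rfl, hΛ, _, h'.mono η hη⟩

theorem stable_ex (hφ : Stable φ.not) : Stable (.ex φ) := by
  intro I Γ e S hS h J Δ π hπ hΔ
  by_contra hn
  refine h J Δ π hπ hΔ fun K Θ ρ hρ a => hφ K Θ _ _ (hS.comp _) fun L Λ η hη hΛ h' => hn ?_
  rw [Formula.not_not] at h'
  exact ⟨L, Λ, fun l => ρ (η l), fun l => (hρ _).trans (hη l), hΛ, _, h'⟩

theorem stable_allSet (hφ : Stable φ) : Stable (.allSet φ) := by
  rintro I Γ e S hS h J Δ π hπ A ⟨m, hA⟩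
  refine hφ J Δ _ _ ((hS.comp π).scons hA) fun K Θ ρ hρ hΘ h' => ?_
  refine h K Θ (fun k => π (ρ k)) (fun k => (hπ _).trans (hρ k)) hΘ fun L Λ η hη hΛ => ?_
  exact ⟨L, Λ, id, fun _ => subset_rfl, hΛ, _, ⟨m, fun _ => hA _⟩, h'.mono η hη⟩

theorem stable_exSet (hφ : Stable φ.not) : Stable (.exSet φ) := by
  intro I Γ e S hS h J Δ π hπ hΔ
  by_contra hn
  refine h J Δ π hπ hΔ ?_
  rintro K Θ ρ hρ A ⟨m, hA⟩
  refine hφ K Θ _ _ ((hS.comp _).scons hA) fun L Λ η hη hΛ h' => hn ?_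
  rw [Formula.not_not] at h'
  exact ⟨L, Λ, fun l => ρ (η l), fun l => (hρ _).trans (hη l), hΛ, _, ⟨m, fun _ => hA _⟩, h'⟩

/-- A formula and its negation are treated together because the disjunctive and existential cases
rest on stability of the negated parts. -/
theorem stable (φ : Formula) : Stable φ ∧ Stable φ.not := by
  induction φ with
  | pos a => exact ⟨stable_pos a, stable_neg a⟩
  | neg a => exact ⟨stable_neg a, stable_pos a⟩
  | and φ ψ ih₁ ih₂ =>
    exact ⟨stable_and ih₁.1 ih₂.1,
      stable_or (by simpa [Formula.not_not] using ih₁.1) (by simpa [Formula.not_not] using ih₂.1)⟩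
  | or φ ψ ih₁ ih₂ => exact ⟨stable_or ih₁.2 ih₂.2, stable_and ih₁.2 ih₂.2⟩
  | all φ ih => exact ⟨stable_all ih.1, stable_ex (by simpa [Formula.not_not] using ih.1)⟩
  | ex φ ih => exact ⟨stable_ex ih.2, stable_all ih.2⟩
  | allSet φ ih => exact ⟨stable_allSet ih.1, stable_exSet (by simpa [Formula.not_not] using ih.1)⟩
  | exSet φ ih => exact ⟨stable_exSet ih.2, stable_allSet ih.2⟩

/-! ### Soundness -/

theorem atom_consistent {a : Atom} (hS : BoundedSets S) (h₁ : Forces (.pos a) I Γ e S)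
    (h₂ : Forces (.neg a) I Γ e S) : Prov Γ :=
  let ⟨_, hk⟩ := (Formula.pos a).exists_rankLE_tr hS
  Prov.cut (fun i => hk i (e i)) h₁ h₂

end Forces

/-- A consistent condition cannot refute all formulas of a derivable sequent. -/
theorem Derivable.sound {Φ : Finset Formula} (h : Derivable Φ) {I : Type} {Γ : I → Set IF}
    {e : I → ℕ → ℕ} {S : I → ℕ → ℕ → IF} (hS : BoundedSets S) (hΓ : ¬ Prov Γ)
    (hΦ : ∀ φ ∈ Φ, Forces φ.not I Γ e S) : False := by
  induction h generalizing I with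
  | ax a h₁ h₂ => exact hΓ (Forces.atom_consistent hS (hΦ _ h₂) (hΦ _ h₁))
  | and φ ψ _ _ hsub ih₁ ih₂ =>
    -- The refuted conjunction is a forced disjunction; some consistent extension settles which
    -- premise to follow.
    obtain ⟨J, Δ, π, hπ, hΔ, h⟩ := hΦ _ (hsub (Finset.mem_insert_self _ _)) I Γ id
      (fun _ => subset_rfl) hΓ
    have hside := fun χ hχ => (hΦ χ (hsub (Finset.mem_insert_of_mem hχ))).mono π hπ
    obtain h | h := h
    · exact ih₁ (hS.comp π) hΔ (Finset.forall_mem_insert .. |>.2 ⟨h, hside⟩)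
    · exact ih₂ (hS.comp π) hΔ (Finset.forall_mem_insert .. |>.2 ⟨h, hside⟩)
  | orLeft φ ψ _ hsub ih =>
    obtain ⟨h, hside⟩ := (Finset.forall_mem_insert ..).1 fun χ hχ => hΦ χ (hsub hχ)
    exact ih hS hΓ (Finset.forall_mem_insert .. |>.2 ⟨h.1, hside⟩)
  | orRight φ ψ _ hsub ih =>
    obtain ⟨h, hside⟩ := (Finset.forall_mem_insert ..).1 fun χ hχ => hΦ χ (hsub hχ)
    exact ih hS hΓ (Finset.forall_mem_insert .. |>.2 ⟨h.2, hside⟩)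
  | all φ _ hsub ih =>
    obtain ⟨h, hside⟩ := (Finset.forall_mem_insert ..).1 fun χ hχ => hΦ χ (hsub hχ)
    obtain ⟨J, Δ, π, hπ, hΔ, a, h⟩ := h I Γ id (fun _ => subset_rfl) hΓ
    refine ih (hS.comp π) hΔ (Finset.forall_mem_insert .. |>.2 ⟨h, ?_⟩)
    refine (Finset.forall_mem_image).2 fun χ hχ => ?_
    rw [Formula.shift, Formula.not_subst, Forces.subst_iff]
    exact (hside χ hχ).mono π hπ
  | ex φ t _ hsub ih =>
    obtain ⟨h, hside⟩ := (Finset.forall_mem_insert ..).1 fun χ hχ => hΦ χ (hsub hχ)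
    refine ih hS hΓ (Finset.forall_mem_insert .. |>.2 ⟨?_, hside⟩)
    rw [Formula.inst, Formula.not_subst, Forces.subst_iff]
    have hσ : (fun i n => Term.val (e i) (match n with | 0 => t | n + 1 => .var n)) =
        fun i => scons (t.val (e i)) (e i) := by
      funext i n
      cases n <;> rfl
    exact hσ ▸ h I Γ id (fun _ => subset_rfl) fun i => t.val (e i)
  | allSet φ _ hsub ih =>
    obtain ⟨h, hside⟩ := (Finset.forall_mem_insert ..).1 fun χ hχ => hΦ χ (hsub hχ)
    obtain ⟨J, Δ, π, hπ, hΔ, A, ⟨m, hA⟩, h⟩ := h I Γ id (fun _ => subset_rfl) hΓ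
    refine ih ((hS.comp π).scons hA) hΔ (Finset.forall_mem_insert .. |>.2 ⟨h, ?_⟩)
    refine (Finset.forall_mem_image).2 fun χ hχ => ?_
    rw [Formula.shiftSet, Formula.not_subst, Forces.subst_iff]
    exact (hside χ hχ).mono π hπ
  | exSet φ k _ hsub ih =>
    obtain ⟨h, hside⟩ := (Finset.forall_mem_insert ..).1 fun χ hχ => hΦ χ (hsub hχ)
    refine ih hS hΓ (Finset.forall_mem_insert .. |>.2 ⟨?_, hside⟩)
    rw [Formula.instSet, Formula.not_subst, Forces.subst_iff]
    obtain ⟨m, hm⟩ := hS k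
    have hτ : (fun i j => S i (match j with | 0 => k | j + 1 => j)) =
        fun i => scons (S i k) (S i) := by
      funext i n
      cases n <;> rfl
    exact hτ ▸ h I Γ id (fun _ => subset_rfl) (fun i => S i k) ⟨m, hm⟩
  | cut φ _ _ hsub ih₁ ih₂ =>
    refine ih₁ hS hΓ (Finset.forall_mem_insert .. |>.2 ⟨?_, fun χ hχ => hΦ χ (hsub hχ)⟩)
    -- The second premise excludes consistent extensions that force `φ.not.not`, so `φ.not` is
    -- forced by stability, as the first premise requires.
    refine (Forces.stable φ).2 I Γ e S hS fun J Δ π hπ hΔ h => ?_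
    exact ih₂ (hS.comp π) hΔ
      (Finset.forall_mem_insert .. |>.2 ⟨h, fun χ hχ => (hΦ χ (hsub hχ)).mono π hπ⟩)

/-! ### Forcing of arithmetical formulas -/

/-- Formulas in a condition count as refuted, so adding a formula's translation or its negation
produces the extensions needed to pass between forcing and derivability. -/
theorem Formula.IsArithmetical.forces_iff {φ : Formula} (hφ : φ.IsArithmetical) {I : Type}
    {Γ : I → Set IF} {e : I → ℕ → ℕ} {S : I → ℕ → ℕ → IF} (hS : BoundedSets S) :
    Forces φ I Γ e S ↔ Prov fun i => insert (φ.tr (e i) (S i)) (Γ i) := by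
  induction φ generalizing I with
  | pos | neg => rfl
  | and φ ψ ih₁ ih₂ =>
    rw [Forces, ih₁ hφ.1 hS, ih₂ hφ.2 hS]
    exact ⟨fun h => Prov.and h.1 h.2, fun h => ⟨h.conj_inversion fun _ => true,
      h.conj_inversion fun _ => false⟩⟩
  | or φ ψ ih₁ ih₂ =>
    constructor
    · intro h
      by_contra hn
      obtain ⟨J, Δ, π, hπ, hΔ, h⟩ := h I _ id (fun i => Set.subset_insert _ _) hn
      rw [ih₁ hφ.1 (hS.comp _), ih₂ hφ.2 (hS.comp _)] at h
      have h' : Prov fun j => insert ((φ.or ψ).tr (e (π j)) (S (π j))) (Δ j) := by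
        obtain h | h := h
        · exact Prov.disj (fun _ => true) h
        · exact Prov.disj (fun _ => false) h
      exact hΔ (h'.weaken id fun j => Set.insert_subset (hπ j (Set.mem_insert _ _)) subset_rfl)
    · intro h J Δ π hπ hΔ
      by_contra hn
      obtain ⟨k, hk⟩ := φ.exists_rankLE_tr hS
      obtain ⟨m, hm⟩ := ψ.exists_rankLE_tr hS
      obtain ⟨l, hl⟩ := (φ.or ψ).exists_rankLE_tr hS
      -- If this failed, the sequents with `¬φ` added would be a consistent extension forcing `φ`.
      -- Likewise for `ψ`; the two negations are then cut against the disjunction.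
      have h₁ : Prov fun j => insert (φ.tr (e (π j)) (S (π j))).neg (Δ j) := by
        by_contra hc
        refine hn ⟨J, _, id, fun j => Set.subset_insert _ _, hc, Or.inl ?_⟩
        exact (ih₁ hφ.1 (hS.comp _)).2
          (Prov.excluded_middle (fun j => hk (π j) (e (π j))) (by simp) (by simp))
      have h₂ : Prov fun j => insert (ψ.tr (e (π j)) (S (π j))).neg (Δ j) := by
        by_contra hc
        refine hn ⟨J, _, id, fun j => Set.subset_insert _ _, hc, Or.inr ?_⟩
        exact (ih₂ hφ.2 (hS.comp _)).2
          (Prov.excluded_middle (fun j => hm (π j) (e (π j))) (by simp) (by simp))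
      refine hΔ (Prov.cut (fun j => hl (π j) (e (π j)))
        (h.weaken π fun j => Set.insert_subset_insert (hπ j)) ?_)
      rw [funext fun j => congrArg (insert · (Δ j)) ((φ.or ψ).tr_not (e (π j)) (S (π j))).symm]
      simp only [Formula.not, Formula.tr, Formula.tr_not]
      exact Prov.and h₁ h₂
  | all φ ih =>
    constructor
    · intro h
      -- The second projection acts as a generic number, covering all instances with one bound.
      have := h (I × ℕ) (fun p => Γ p.1) Prod.fst (fun _ => subset_rfl) Prod.snd
      rw [ih hφ (hS.comp _)] at this
      exact Prov.conj this
    · intro h J Δ π hπ a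
      rw [ih hφ (hS.comp _)]
      have h' : Prov fun j => insert ((Formula.all φ).tr (e (π j)) (S (π j))) (Δ j) :=
        h.weaken π fun j => Set.insert_subset_insert (hπ j)
      exact h'.conj_inversion a
  | ex φ ih =>
    constructor
    · intro h
      by_contra hn
      obtain ⟨J, Δ, π, hπ, hΔ, a, h⟩ := h I _ id (fun i => Set.subset_insert _ _) hn
      rw [ih hφ (hS.comp _)] at h
      have h' : Prov fun j => insert ((Formula.ex φ).tr (e (π j)) (S (π j))) (Δ j) :=
        Prov.disj a h
      exact hΔ (h'.weaken id fun j => Set.insert_subset (hπ j (Set.mem_insert _ _)) subset_rfl)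
    · intro h J Δ π hπ hΔ
      by_contra hn
      obtain ⟨k, hk⟩ := φ.exists_rankLE_tr hS
      obtain ⟨l, hl⟩ := (Formula.ex φ).exists_rankLE_tr hS
      have h₁ : Prov fun p : J × ℕ =>
          insert (φ.tr (scons p.2 (e (π p.1))) (S (π p.1))).neg (Δ p.1) := by
        by_contra hc
        refine hn ⟨J × ℕ, _, Prod.fst, fun j => Set.subset_insert _ _, hc, Prod.snd, ?_⟩
        exact (ih hφ (hS.comp _)).2
          (Prov.excluded_middle (fun p => hk (π p.1) (scons p.2 (e (π p.1)))) (by simp) (by simp))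
      exact hΔ (Prov.cut (fun j => hl (π j) (e (π j)))
        (h.weaken π fun j => Set.insert_subset_insert (hπ j)) (Prov.conj h₁))
  | allSet | exSet => exact hφ.elim

/-! ### Truth over finite descending sequences -/

/-- `φ` is true, where the truth values of atoms are decided by `s`. -/
def IF.Holds (s : List ℕ) : IF → Prop
  | lit b n => Decides s b n
  | conj _ f => ∀ i, (f i).Holds s
  | disj _ f => ∃ i, (f i).Holds s

theorem IF.holds_ofProp {s : List ℕ} {p : Prop} : (ofProp p).Holds s ↔ p := by
  by_cases h : p <;> simp [ofProp, h, Holds]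

theorem InfDerivable.of_holds {φ : IF} {s : List ℕ} {m k : ℕ} {Γ : Set IF} (hr : φ.RankLE m)
    (h : φ.Holds s) (hφ : φ ∈ Γ) : InfDerivable m k s Γ := by
  induction φ generalizing m Γ with
  | lit b n => exact .lit b n hφ h
  | conj ι f ih =>
    cases m with
    | zero => exact hr.elim
    | succ m =>
      exact .conj ι f hφ (by simp) fun i => ih i (hr i) (h i) (Set.mem_insert _ _)
  | disj ι f ih =>
    cases m with
    | zero => exact hr.elim
    | succ m =>
      obtain ⟨i, h⟩ := h
      exact .disj ι f i hφ (by simp) (ih i (hr i) h (Set.mem_insert _ _))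

/-- The number `d` of queries may vary with `i`, but `m + d` always stays below `ω`. -/
theorem Prov.of_holds {I : Type} {P : I → IF} {Γ : I → Set IF} {m : ℕ} (hr : ∀ i, (P i).RankLE m)
    (h : ∀ i, ∃ d, ∀ s : List ℕ, Descending s → d ≤ s.length → (P i).Holds s) :
    Prov fun i => insert (P i) (Γ i) := by
  refine ⟨ω, omega0_lt_epsilon 0, 0, fun i => ?_⟩
  obtain ⟨d, hd⟩ := h i
  refine (InfDerivable.query_until (β := m) List.Pairwise.nil (m := d) (d := d) (by simp)
    fun s _ hs hs' => ?_).weaken ?_ le_rfl subset_rfl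
  · exact .of_holds (hr i) (hd s hs hs') (Set.mem_insert _ _)
  · exact_mod_cast (natCast_lt_omega0 (m + d)).le

theorem forces_of_holds {φ : Formula} (hφ : φ.IsArithmetical) {I : Type} {Γ : I → Set IF}
    {e : I → ℕ → ℕ} {S : I → ℕ → ℕ → IF} (hS : BoundedSets S)
    (h : ∀ i, ∃ d, ∀ s : List ℕ, Descending s → d ≤ s.length → (φ.tr (e i) (S i)).Holds s) :
    Forces φ I Γ e S :=
  let ⟨_, hm⟩ := φ.exists_rankLE_tr hS
  (hφ.forces_iff hS).2 (Prov.of_holds (fun i => hm i (e i)) h)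

namespace Formula

/-- The formula has no set variables. -/
def SetFree : Formula → Prop
  | .pos (.mem _ _) => False
  | .neg (.mem _ _) => False
  | .pos _ => True
  | .neg _ => True
  | .and φ ψ => φ.SetFree ∧ ψ.SetFree
  | .or φ ψ => φ.SetFree ∧ ψ.SetFree
  | .all φ => φ.SetFree
  | .ex φ => φ.SetFree
  | .allSet _ => False
  | .exSet _ => False

/-- Truth of the translation of a formula. -/
def Holds (s : List ℕ) (e : ℕ → ℕ) (S : ℕ → ℕ → IF) (φ : Formula) : Prop := (φ.tr e S).Holds s

variable {s : List ℕ} {e : ℕ → ℕ} {S : ℕ → ℕ → IF} {φ ψ : Formula}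

theorem holds_eq {a b : Term} : (pos (.eq a b)).Holds s e S ↔ a.val e = b.val e := holds_ofProp

theorem holds_le {a b : Term} : (pos (.le a b)).Holds s e S ↔ a.val e ≤ b.val e := holds_ofProp

theorem holds_ne {a b : Term} : (neg (.eq a b)).Holds s e S ↔ a.val e ≠ b.val e := by
  simp [Holds, tr, Atom.tr, neg_ofProp, holds_ofProp]

theorem holds_not_le {a b : Term} : (neg (.le a b)).Holds s e S ↔ ¬ a.val e ≤ b.val e := by
  simp [Holds, tr, Atom.tr, neg_ofProp, holds_ofProp]

theorem holds_and : (φ ⋏ ψ).Holds s e S ↔ φ.Holds s e S ∧ ψ.Holds s e S := by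
  simp [Holds, tr, IF.Holds, and_comm]

theorem holds_or : (φ ⋎ ψ).Holds s e S ↔ φ.Holds s e S ∨ ψ.Holds s e S := by
  simp [Holds, tr, IF.Holds, or_comm]

theorem holds_all : (all φ).Holds s e S ↔ ∀ n, φ.Holds s (scons n e) S := Iff.rfl

theorem holds_ex : (ex φ).Holds s e S ↔ ∃ n, φ.Holds s (scons n e) S := Iff.rfl

/-- Truth is classical without set atoms; a short sequence may decide neither a literal nor its
negation. -/
theorem SetFree.holds_not (hφ : φ.SetFree) : φ.not.Holds s e S ↔ ¬ φ.Holds s e S := by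
  induction φ generalizing e with
  | pos a => cases a <;> simp_all [SetFree, Formula.not, holds_eq, holds_ne, holds_le, holds_not_le]
  | neg a => cases a <;> simp_all [SetFree, Formula.not, holds_eq, holds_ne, holds_le, holds_not_le]
  | and φ ψ ih₁ ih₂ => simp only [Formula.not, holds_and, holds_or, ih₁ hφ.1, ih₂ hφ.2]; tauto
  | or φ ψ ih₁ ih₂ => simp only [Formula.not, holds_and, holds_or, ih₁ hφ.1, ih₂ hφ.2]; tauto
  | all φ ih => simp [Formula.not, holds_all, holds_ex, ih hφ]
  | ex φ ih => simp [Formula.not, holds_all, holds_ex, ih hφ]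
  | allSet | exSet => exact hφ.elim

theorem SetFree.isArithmetical (hφ : φ.SetFree) : φ.IsArithmetical := by
  induction φ with
  | pos | neg => trivial
  | and φ ψ ih₁ ih₂ | or φ ψ ih₁ ih₂ => exact ⟨ih₁ hφ.1, ih₂ hφ.2⟩
  | all φ ih | ex φ ih => exact ih hφ
  | allSet | exSet => exact hφ.elim

theorem holds_imp (hφ : φ.SetFree) :
    (imp φ ψ).Holds s e S ↔ (φ.Holds s e S → ψ.Holds s e S) := by
  rw [imp, holds_or, hφ.holds_not]
  tauto

theorem holds_iff (hφ : φ.SetFree) (hψ : ψ.SetFree) :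
    (iff φ ψ).Holds s e S ↔ (φ.Holds s e S ↔ ψ.Holds s e S) := by
  rw [iff, holds_and, holds_imp hφ, holds_imp hψ]
  tauto

end Formula

/-! ### Truth of the formulas about trees -/

/-- Membership in the finite set with code `(k, c, d)`. -/
def FinMem (x k c d : ℕ) : Prop := x < k ∧ ∃ q, q * (d * (x + 1) + 1) = c

section Trees

open Formula Term

variable {s : List ℕ} {e : ℕ → ℕ} {S : ℕ → ℕ → IF} {x y z k c d : Term}

theorem holds_lt : (lt x y).Holds s e S ↔ x.val e < y.val e := by
  rw [lt, holds_and, holds_le, holds_ne, lt_iff_le_and_ne]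

theorem holds_isPair : (isPair z x y).Holds s e S ↔ IsPair (z.val e) (x.val e) (y.val e) :=
  holds_eq

theorem holds_isLeaf : (isLeaf z).Holds s e S ↔ z.val e = 0 := holds_eq

theorem holds_isNode : (isNode z x y).Holds s e S ↔
    ∃ p, IsPair p (x.val e) (y.val e) ∧ z.val e = p + 1 := by
  simp [isNode, holds_ex, holds_and, holds_isPair, holds_eq, val_lift, val]

theorem holds_inFin : (inFin x k c d).Holds s e S ↔
    FinMem (x.val e) (k.val e) (c.val e) (d.val e) := by
  simp [inFin, holds_ex, holds_and, holds_lt, holds_eq, val_lift, val, FinMem]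

theorem holds_pairInFin : (pairInFin x y k c d).Holds s e S ↔
    ∃ p, IsPair p (x.val e) (y.val e) ∧ FinMem p (k.val e) (c.val e) (d.val e) := by
  simp [pairInFin, holds_ex, holds_and, holds_isPair, holds_inFin, val_lift, val]

theorem setFree_inFin : (inFin x k c d).SetFree := by simp [inFin, lt, SetFree]

theorem setFree_pairInFin : (pairInFin x y k c d).SetFree := by
  simp [pairInFin, isPair, setFree_inFin, SetFree]

theorem setFree_lt : (lt x y).SetFree := by simp [lt, SetFree]

theorem setFree_isPair : (isPair z x y).SetFree := by simp [isPair, SetFree]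

theorem setFree_isTree : (isTree x).SetFree := by
  simp [isTree, exs, Formula.imp, inFin, lt, isLeaf, isNode, isPair, Formula.not, SetFree]

theorem setFree_treeLe : (treeLe x y).SetFree := by
  simp [treeLe, exs, alls, Formula.imp, pairInFin, inFin, lt, isLeaf, isNode, isPair, Formula.not,
    SetFree]

theorem holds_isTree : (isTree x).Holds s e S := by
  simp only [isTree, exs, holds_ex, holds_and, holds_all, holds_imp setFree_inFin, holds_inFin,
    holds_or, holds_isLeaf, holds_isNode, val_lift, val, scons]
  -- Everything divides `c = 0`, so this code denotes the initial segment up to `x`, which contains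
  -- the components of its elements: every number codes a tree.
  refine ⟨x.val e + 1, 0, 0, ⟨Nat.lt_succ_self _, 0, by simp⟩, fun u hu => ?_⟩
  cases u with
  | zero => exact Or.inl rfl
  | succ u =>
    obtain ⟨a, b, h⟩ := exists_unpair u
    refine Or.inr ⟨a, b, ⟨u, h, rfl⟩, ⟨?_, 0, by simp⟩, ?_, 0, by simp⟩
    · have := h.le.1
      have := hu.1
      omega
    · have := h.le.2
      have := hu.1
      omega

theorem treeOrd_le_of_holds_treeLe (h : (treeLe x y).Holds s e S) :
    treeOrd (x.val e) ≤ treeOrd (y.val e) := by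
  simp only [treeLe, exs, alls, holds_ex, holds_and, holds_all, holds_imp setFree_pairInFin,
    holds_pairInFin, holds_or, holds_isLeaf, holds_isNode, val_lift, val, scons] at h
  obtain ⟨k, c, d, h, hR⟩ := h
  refine treeOrd_le_of_verified (R := fun u v => ∃ p, IsPair p u v ∧ FinMem p k c d)
    (fun u v huv => ?_) h
  obtain h | ⟨u₀, u₁, v₀, v₁, h⟩ := hR u v huv
  · exact Or.inl h
  · exact Or.inr ⟨u₀, u₁, v₀, v₁, h⟩

end Trees

/-! ### The axioms are forced -/

/-- All conditions force `φ`. -/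
def Valid (φ : Formula) : Prop :=
  ∀ (I : Type) (Γ : I → Set IF) (e : I → ℕ → ℕ) (S : I → ℕ → ℕ → IF), BoundedSets S →
    Forces φ I Γ e S

theorem Valid.allSets {φ : Formula} (h : Valid φ) (m : ℕ) : Valid (.allSets m φ) := by
  induction m with
  | zero => exact h
  | succ m ih => exact fun I Γ e S hS J Δ π _ A ⟨_, hA⟩ => ih J Δ _ _ ((hS.comp π).scons hA)

theorem Valid.alls {φ : Formula} (h : Valid φ) (n : ℕ) : Valid (.alls n φ) := by
  induction n with
  | zero => exact h
  | succ n ih => exact fun I Γ e S hS J Δ π _ a => ih J Δ _ _ (hS.comp π)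

theorem Formula.IsArithmetical.valid {φ : Formula} (hφ : φ.IsArithmetical)
    (h : ∀ s e S, φ.Holds s e S) : Valid φ := fun _ _ _ _ hS =>
  forces_of_holds hφ hS fun _ => ⟨0, fun s _ _ => h s _ _⟩

/-- The translation of `φ`, as a function of its first variable, is itself an admissible set; its
rank is bounded. Both implications reduce to excluded middle. -/
theorem valid_comprehension {φ : Formula} (hφ : φ.IsArithmetical) : Valid (comprehension φ) := by
  intro I Γ e S hS J Δ π hπ hΔ
  obtain ⟨k, hk⟩ := φ.exists_rankLE_tr hS
  let A : J → ℕ → IF := fun j n => φ.tr (scons n (e (π j))) (S (π j))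
  have hA : ∀ j n, (A j n).RankLE k := fun j n => hk _ _
  refine ⟨J, Δ, id, fun _ => subset_rfl, hΔ, A, ⟨k, hA⟩, ?_⟩
  have hφ' := hφ.subst Term.var (fun j => j + 1)
  have hiff : (Formula.all ((Formula.pos (.mem (.var 0) 0)).iff φ.shiftSet)).IsArithmetical :=
    ⟨⟨trivial, hφ'⟩, hφ'.not, trivial⟩
  refine (hiff.forces_iff ((hS.comp π).scons hA)).2 (Prov.conj ?_)
  simp only [Formula.iff, Formula.imp, Formula.tr, Formula.not, Atom.tr, Formula.tr_not,
    Formula.shiftSet, Formula.tr_subst, Term.val, scons, id]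
  refine Prov.and (Prov.or ?_) (Prov.or ?_)
  · exact Prov.excluded_middle (P := fun p : J × ℕ => A p.1 p.2) (fun p => hA p.1 p.2)
      (fun p => Or.inr (Or.inl rfl)) fun p => Or.inl rfl
  · exact Prov.excluded_middle (P := fun p : J × ℕ => A p.1 p.2) (fun p => hA p.1 p.2)
      (fun p => Or.inr (Or.inl rfl)) fun p => Or.inl rfl

/-- The disjunction `h₁` negates the induction step. Using its instances `n - 1, …, 0` reduces `A n`
to `A 0`, so the height grows with `n` but remains below `ω + ω`. -/
theorem InfDerivable.induction {A : ℕ → IF} {m k : ℕ} (hA : ∀ n, (A n).RankLE m) {s : List ℕ}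
    (hs : Descending s) {Γ : Set IF} (h₀ : (A 0).neg ∈ Γ)
    (h₁ : (.disj ℕ fun n => .conj Bool fun b => cond b (A n) (A (n + 1)).neg) ∈ Γ) (n : ℕ) :
    InfDerivable (ω + (m * 2 + n * 2 : ℕ)) k s (insert (A n) Γ) := by
  have lt : ∀ {a b : ℕ}, a < b → ω + (a : Ordinal.{0}) < ω + b := fun h =>
    add_lt_add_right (by exact_mod_cast h) _
  induction n generalizing Γ with
  | zero => exact .excluded_middle (hA 0) hs (Set.mem_insert _ _) (Or.inr h₀)
  | succ n ih =>
    refine .disj (β := ω + (m * 2 + n * 2 + 1 : ℕ)) ℕ _ n (Or.inr h₁) (lt (by omega)) ?_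
    refine .conj Bool _ (Set.mem_insert _ _) (lt (Nat.lt_succ_self _)) fun b => ?_
    cases b
    · exact (InfDerivable.excluded_middle (hA (n + 1)) hs (by simp) (by simp)).weaken
        (add_le_add_right (by exact_mod_cast Nat.le_add_right _ _) _) le_rfl subset_rfl
    · exact ih (Or.inr (Or.inr h₀)) (Or.inr (Or.inr h₁))

theorem valid_setInduction : Valid setInduction := by
  rintro I Γ e S hS J Δ π hπ A ⟨m, hA⟩
  refine (Formula.IsArithmetical.forces_iff (by simp [Formula.imp, Formula.not,
    Formula.IsArithmetical]) ((hS.comp π).scons hA)).2 ?_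
  simp only [Formula.imp, Formula.tr, Formula.not, Atom.tr, Term.val, scons]
  refine Prov.or (Prov.or ?_)
  have h : Prov fun j => insert (.conj ℕ (A j)) (insert (A j 0).neg (insert
      (.disj ℕ fun n => .conj Bool fun b => cond b (A j n) (A j (n + 1)).neg) (Δ j))) := by
    refine Prov.conj ⟨ω + ω, add_lt_epsilon_zero (omega0_lt_epsilon 0) (omega0_lt_epsilon 0), 0,
      fun ⟨j, n⟩ => ?_⟩
    exact (InfDerivable.induction (hA j) List.Pairwise.nil (by simp) (by simp) n).weaken
      (add_le_add_right (natCast_lt_omega0 _).le _) le_rfl subset_rfl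
  refine h.weaken id fun j => ?_
  intro φ hφ
  simp only [Set.mem_insert_iff, id] at hφ ⊢
  tauto

theorem EqualityAxiom.valid {φ : Formula} (h : EqualityAxiom φ) : Valid φ := by
  open Formula in
  cases h with
  | mem =>
    rintro I Γ e S hS J Δ π hπ A ⟨m, hA⟩
    refine (Formula.IsArithmetical.forces_iff (by simp [Formula.imp, Formula.not, alls,
      Formula.IsArithmetical]) ((hS.comp π).scons hA)).2 ?_
    simp only [Formula.imp, alls, Formula.tr, Formula.not, Atom.tr, Term.val, scons, neg_ofProp]
    refine Prov.conj (Prov.conj (Prov.or (Prov.or ?_)))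
    refine ⟨ω + (m * 2 + 1 : ℕ), add_natCast_lt_epsilon_zero (omega0_lt_epsilon 0) _, 0, ?_⟩
    -- For equal values this is excluded middle for `A j x`; otherwise the negated equation is true
    -- outright.
    rintro ⟨⟨j, y⟩, x⟩
    by_cases hxy : x = y
    · subst hxy
      exact (InfDerivable.excluded_middle (hA j x) List.Pairwise.nil (by simp) (by simp)).weaken
        (add_le_add_right (by exact_mod_cast Nat.le_succ _) _) le_rfl subset_rfl
    · exact (InfDerivable.of_holds (rankLE_ofProp _) (holds_ofProp.2 hxy) (Or.inl rfl)).weaken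
        ((natCast_lt_omega0 1).le.trans le_self_add) le_rfl subset_rfl
  | _ =>
    refine Valid.alls (Formula.IsArithmetical.valid
      (by simp [Formula.imp, Formula.not, Formula.IsArithmetical]) fun s e S => ?_) _
    simp [Formula.imp, Formula.not, holds_eq, holds_ne, holds_le, holds_not_le, holds_or,
      Term.val]
    try grind

theorem RobinsonAxiom.valid {φ : Formula} (h : RobinsonAxiom φ) : Valid φ := by
  open Formula in
  cases h <;>
    refine Valid.alls (Formula.IsArithmetical.valid
      (by simp [Formula.iff, Formula.imp, Formula.not, Formula.IsArithmetical]) fun s e S => ?_) _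
  case exists_pred =>
    rw [imp, holds_or, Formula.not, holds_eq, holds_ex]
    simp only [holds_eq, Term.val, scons]
    exact (e 0).eq_zero_or_eq_succ_pred.imp_right fun h => ⟨_, h⟩
  case le_iff =>
    rw [Formula.holds_iff (by simp [SetFree]) (by simp [SetFree]), holds_le, holds_ex]
    simp only [holds_eq, Term.val, scons]
    exact ⟨fun h => ⟨_, Nat.sub_add_cancel h⟩, fun ⟨_, h⟩ => h ▸ Nat.le_add_left _ _⟩
  all_goals simp [Formula.imp, Formula.not, holds_eq, holds_ne, holds_or, Term.val]
  case succ_inj => exact em' _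
  all_goals ring

theorem ACA0.valid {φ : Formula} (h : ACA0 φ) : Valid φ := by
  cases h with
  | equality h => exact h.valid
  | robinson h => exact h.valid
  | induction => exact valid_setInduction
  | comprehension φ n m hφ => exact ((valid_comprehension hφ).alls n).allSets m

/-! ### Kruskal's theorem is not forced -/

theorem forces_alls {φ : Formula} {I : Type} {Γ : I → Set IF} {e : I → ℕ → ℕ}
    {S : I → ℕ → ℕ → IF} (n : ℕ)
    (h : ∀ (J : Type) (Δ : J → Set IF) (π : J → I) (e' : J → ℕ → ℕ),
      Forces φ J Δ e' fun j => S (π j)) : Forces (.alls n φ) I Γ e S := by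
  induction n generalizing I with
  | zero => exact h I Γ id e
  | succ n ih => exact fun J Δ π _ a => ih fun K Θ ρ => h K Θ fun k => π (ρ k)

/-- The witness is the generic set, with `lit true n` for `n ∈ X`. Each instance of totality, and
each instance of the absence of a good pair, is true over every sufficiently long descending
sequence. -/
theorem forces_not_kruskalBinary {I : Type} {Γ : I → Set IF} {e : I → ℕ → ℕ}
    {S : I → ℕ → ℕ → IF} (hS : BoundedSets S) : Forces kruskalBinary.not I Γ e S := by
  intro J Δ π hπ hΔ
  have hr : ∀ (_ : J) n, (lit true n).RankLE 0 := fun _ _ => trivial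
  refine ⟨J, Δ, id, fun _ => subset_rfl, hΔ, fun _ n => .lit true n, ⟨0, hr⟩, ?_⟩
  have hS' := (hS.comp π).scons hr
  constructor
  · rw [Formula.not_not]
    refine fun K Θ ρ hρ a => forces_of_holds ?_ (hS'.comp ρ) fun k => ⟨a k + 1, fun s _ hd => ?_⟩
    · exact ⟨setFree_isTree.isArithmetical, setFree_isPair.isArithmetical, trivial⟩
    obtain ⟨p, hp⟩ := exists_isPair (a k) s[a k]
    refine ⟨s[a k], p, ?_⟩
    change Formula.Holds _ _ _ _
    rw [Formula.exs, Formula.holds_and, Formula.holds_and, holds_isPair]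
    exact ⟨holds_isTree, hp, a k, s[a k], hp, s[a k], List.getElem?_eq_getElem _, by simp⟩
  · rw [Formula.not_exs]
    refine forces_alls 6 fun K Θ ρ e' => forces_of_holds (Formula.IsArithmetical.not ?_)
      (hS'.comp ρ) fun k => ⟨max (e' k 5) (e' k 4) + 1, fun s hs hd => ?_⟩
    · exact ⟨setFree_lt.isArithmetical, setFree_isTree.isArithmetical,
        setFree_isTree.isArithmetical, setFree_isPair.isArithmetical,
        setFree_isPair.isArithmetical, trivial, trivial, setFree_treeLe.isArithmetical⟩
    change Formula.Holds _ _ _ _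
    simp only [Formula.not, Formula.holds_or, setFree_lt.holds_not, setFree_isTree.holds_not,
      setFree_isPair.holds_not, setFree_treeLe.holds_not, holds_lt, holds_isPair, Term.val]
    by_contra! hn
    obtain ⟨hij, -, -, hp, hq, hp', hq', hle⟩ := hn
    -- A sequence long enough to have an entry at `i` refutes `⟨i, t⟩ ∈ X` for every other `t`.
    have key : ∀ {p i t : ℕ} (hi : i < s.length), IsPair p i t → ¬ Decides s false p →
        t = s[i] := fun {p i t} hi hp hd => by
      by_contra h
      exact hd ⟨i, t, hp, s[i], List.getElem?_eq_getElem hi, by simpa using h⟩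
    have hi : e' k 5 < s.length := by omega
    have hj : e' k 4 < s.length := by omega
    have hle := treeOrd_le_of_holds_treeLe hle
    simp only [Term.val, key hi hp hp', key hj hq hq'] at hle
    exact hle.not_gt (List.pairwise_iff_getElem.1 hs _ _ hi hj hij)

/-- The single empty sequent is a consistent condition, and it forces the axioms together with the
negation of Kruskal's theorem. -/
theorem not_provable_kruskalBinary : ¬ Provable ACA0 kruskalBinary := by
  rintro ⟨Ψ, hΨ, h⟩
  have hS : BoundedSets fun (_ : Unit) _ n => lit true n := fun _ => ⟨0, fun _ _ => trivial⟩
  refine h.sound (Γ := fun _ => ∅) (e := fun _ _ => 0) hS ?_ (Finset.forall_mem_insert .. |>.2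
    ⟨forces_not_kruskalBinary hS, Finset.forall_mem_image.2 fun ψ hψ => ?_⟩)
  · rintro ⟨α, hα, k, h⟩
    exact (h ()).not_empty hα
  · rw [Formula.not_not]
    exact (hΨ ψ hψ).valid _ _ _ _ hS

end SecondOrderArith

/-- `ACA₀` does not prove Kruskal's theorem for binary trees. -/
theorem theorem6p5 :
    ¬ SecondOrderArith.Provable SecondOrderArith.ACA0 SecondOrderArith.kruskalBinary :=
  SecondOrderArith.not_provable_kruskalBinary
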